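/- Let $k\in\mathbb{R}$, $k\neq 0$. Put $\varphi_1(z)=z$ on $\Omega_1=\mathbb{R}^3$, and for $k\ne 1$ put $\varphi_k(z)=\frac{2}{k-1}\log z$ on $\Omega_k=\{(x,y,z)\in\mathbb{R}^3: z>0\}$. Let $\Sigma$ be a connected smooth surface and $\widetilde\psi:\Sigma\to\Omega_k$ a smooth immersion which is minimal for the weighted area $\int e^{\varphi_k}\,d\Sigma$, that is, its mean curvature vector (the trace of the second fundamental form) satisfies $\mathbf{H}=(\overline\nabla\varphi_k)^{\perp}$ (a translating soliton if $k=1$, a $\frac{2}{k-1}$-singular minimal surface if $k\neq1$). Let $N=(N_1,N_2,N_3)$ be a continuous unit normal field with $N\neq(0,0,-1)$ everywhere, and let $G=\frac{N_1+iN_2}{1+N_3}:\Sigma\to\mathbb{C}$ be the Euclidean Gauss map (the stereographic projection of $N$ from $(0,0,-1)$). Suppose that $G=\zeta_0\,m$ with a constant $\zeta_0\in\mathbb{C}$, $|\zeta_0|=1$, and a function $m:\Sigma\to\mathbb{R}$, and that $G$ is not constant. Let $R$ be the rotation about the vertical axis given by $x+iy\mapsto-\zeta_0(x+iy)$. (1)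 If $k=1$, then $\widetilde\psi(\Sigma)$ lies on a grim reaper cylinder, i.e. on the image under a vertical rotation and a translation of the surface $z=-\log\cos x$, $|x|<\pi/2$. More precisely, there are $b\in\mathbb{R}^3$ and smooth functions $u,v:\Sigma\to\mathbb{R}$ such that on $\Sigma$ $$\widetilde\psi=b+R\bigl(2\arctan(\tanh u),\,2v,\,\log(\cosh^2u+\sinh^2u)\bigr),$$ the cylinder being the set of all values of the right-hand side for $(u,v)\in\mathbb{R}^2$; moreover $m=\tanh u$ at all points where $|m|<1$. (2) If $k\neq1$, then $\widetilde\psi(\Sigma)$ lies on a $\frac{2}{k-1}$-singular minimal catenary cylinder, i.e. on the image under a vertical rotation of a surface $z=f(x)$, where $f>0$ is a maximal solution, on an open interval, of $\frac{f''}{1+f'^2}=\frac{2}{k-1}\cdot\frac1f$. More precisely, there are an open interval $J$, a solution $\mu:J\to(-1,1)$, onto $(-1,1)$, of $$\mu'(1+\mu^2)^{\frac{k-1}{2}}=(1-\mu^2)^{\frac{k+1}{2}},$$ a function $\mathcal I$ on $J$ with $\mathcal I'=\frac{\mu'}{1+\mu^2}\left(\frac{1+\mu^2}{1-\mu^2}\right)^{\frac{k-1}{2}}$,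 a constant $c\in\mathbb{R}$ with $\frac{ck}{k-1}>0$, a horizontal vector $b\in\mathbb{R}^3$, and smooth functions $u:\Sigma\to J$, $v:\Sigma\to\mathbb{R}$ such that on $\Sigma$ $$\widetilde\psi=b+c\,R\left(2k\,\mathcal I(u),\,2kv,\,\frac{2k}{k-1}\left(\frac{1+\mu(u)^2}{1-\mu(u)^2}\right)^{\frac{k-1}{2}}\right),$$ the cylinder being the set of all values of the right-hand side for $(u,v)\in J\times\mathbb{R}$; moreover $m=\mu(u)$ at all points where $|m|<1$. -/

import Mathlib

open Set Real
open scoped Manifold ContDiff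

noncomputable section

namespace SingularMinimal

/-- Euclidean three-space; the coordinates `(x, y, z)` of `p` are `p 0, p 1, p 2`. -/
abbrev E3 : Type := EuclideanSpace ℝ (Fin 3)

/-- The parameter plane. -/
abbrev E2 : Type := EuclideanSpace ℝ (Fin 2)

/-! ### The weight and the weighted minimal surface equation -/

/-- The weight `φ_k`: `φ_1(z) = z`, and `φ_k(z) = 2/(k-1) log z` (on `z > 0`) for `k ≠ 1`. -/
def weight (k z : ℝ) : ℝ :=
  if k = 1 then z else 2 / (k - 1) * Real.log z

/-- The domain `Ω_k` of the weight: all of `ℝ³` for `k = 1`, the upper half space otherwise. -/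
def weightDomain (k : ℝ) : Set E3 := {p | k ≠ 1 → 0 < p 2}

/-- First partial derivative `X_i` of a parametrization. -/
def partialOne (X : E2 → E3) (i : Fin 2) (q : E2) : E3 :=
  fderiv ℝ X q (EuclideanSpace.single i 1)

/-- Second partial derivative `X_ij` of a parametrization. -/
def partialTwo (X : E2 → E3) (i j : Fin 2) (q : E2) : E3 :=
  fderiv ℝ (partialOne X j) q (EuclideanSpace.single i 1)

/-- The first fundamental form `g_ij = ⟨X_i, X_j⟩`. -/
def firstForm (X : E2 → E3) (q : E2) : Matrix (Fin 2) (Fin 2) ℝ :=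
  Matrix.of fun i j => inner ℝ (partialOne X i q) (partialOne X j q)

/-- The component of `w` orthogonal to the tangent plane of the parametrization `X` at `q`. -/
def normalPart (X : E2 → E3) (q : E2) (w : E3) : E3 :=
  (Submodule.span ℝ (Set.range fun i => partialOne X i q))ᗮ.starProjection w

/-- The mean curvature vector `H = ∑ g^{ij} (X_ij)^⊥`, the trace of the second fundamental form
(the sum, not the mean, of the principal curvatures). -/
def meanCurvatureVector (X : E2 → E3) (q : E2) : E3 :=
  ∑ i, ∑ j, (firstForm X q)⁻¹ i j • normalPart X q (partialTwo X i j q)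

/-- `ψ` is a smooth immersion of the surface `M` into `Ω_k` which is minimal for the weighted area
`∫ e^{φ_k}`: in every local parametrization `X` one has `H = (∇ φ_k)^⊥`.
For `k = 1` these are the translating solitons, for `k ≠ 1` the `2/(k-1)`-singular minimal
surfaces. -/
structure IsWeightedMinimal {M : Type*} [TopologicalSpace M] [ChartedSpace E2 M]
    (k : ℝ) (ψ : M → E3) : Prop where
  smooth : ContMDiff (𝓡 2) 𝓘(ℝ, E3) ∞ ψ
  immersion : ∀ p, Function.Injective (mfderiv (𝓡 2) 𝓘(ℝ, E3) ψ p)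
  mem_domain : ∀ p, ψ p ∈ weightDomain k
  equation : ∀ e ∈ IsManifold.maximalAtlas (𝓡 2) ∞ M, ∀ q ∈ e.target,
    meanCurvatureVector (ψ ∘ e.symm) q =
      normalPart (ψ ∘ e.symm) q (gradient (fun x : E3 => weight k (x 2)) (ψ (e.symm q)))

/-! ### The Euclidean Gauss map -/

/-- `N` is a (continuous) unit normal field of `ψ`. -/
structure IsUnitNormal {M : Type*} [TopologicalSpace M] [ChartedSpace E2 M]
    (ψ N : M → E3) : Prop where
  continuous : Continuous N
  norm_eq_one : ∀ p, ‖N p‖ = 1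
  orthogonal : ∀ p (w : TangentSpace (𝓡 2) p),
    inner ℝ (N p) (mfderiv (𝓡 2) 𝓘(ℝ, E3) ψ p w : E3) = 0

/-- Stereographic projection from the south pole `(0,0,-1)` (meaningful for `n 2 ≠ -1`). -/
def southStereo (n : E3) : ℂ := (⟨n 0, n 1⟩ : ℂ) / ((1 + n 2 : ℝ) : ℂ)

/-! ### Grim reaper cylinders and singular minimal catenary cylinders -/

/-- The rotation about the vertical axis which multiplies the horizontal coordinate `x + i y`
by the unit complex number `τ`. -/
def verticalRotation (τ : ℂ) (p : E3) : E3 :=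
  !₂[(τ * ⟨p 0, p 1⟩).re, (τ * ⟨p 0, p 1⟩).im, p 2]

/-- A grim reaper cylinder: up to a vertical rotation and a translation, the surface
`z = -log (cos x)`, `-π/2 < x < π/2`. -/
def IsGrimReaperCylinder (S : Set E3) : Prop :=
  ∃ (τ : ℂ) (b : E3), ‖τ‖ = 1 ∧
    S = (fun p => b + verticalRotation τ p) ''
      {p : E3 | p 0 ∈ Ioo (-(π / 2)) (π / 2) ∧ p 2 = -Real.log (Real.cos (p 0))}

/-- `f` is a positive solution of `f'' / (1 + f'^2) = α / f` on the nonempty open interval `J`. -/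
structure IsCatenary (α : ℝ) (J : Set ℝ) (f : ℝ → ℝ) : Prop where
  isOpen : IsOpen J
  ordConnected : J.OrdConnected
  nonempty : J.Nonempty
  pos : ∀ x ∈ J, 0 < f x
  diff : ∀ x ∈ J, DifferentiableAt ℝ f x
  diff_deriv : ∀ x ∈ J, DifferentiableAt ℝ (deriv f) x
  ode : ∀ x ∈ J, deriv (deriv f) x / (1 + deriv f x ^ 2) = α / f x

/-- An `α`-singular minimal catenary cylinder: up to a vertical rotation, the surface `z = f x`
with `f` a maximal solution of the `α`-catenary equation. -/
def IsCatenaryCylinder (α : ℝ) (S : Set E3) : Prop :=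
  ∃ (τ : ℂ) (J : Set ℝ) (f : ℝ → ℝ), ‖τ‖ = 1 ∧ IsCatenary α J f ∧
    (∀ (J' : Set ℝ) (g : ℝ → ℝ), IsCatenary α J' g → J ⊆ J' → EqOn f g J → J' = J) ∧
    S = verticalRotation τ '' {p : E3 | p 0 ∈ J ∧ p 2 = f (p 0)}

/-- The explicit conformal parametrization of the grim reaper cylinder. -/
def grimReaperMap (u v : ℝ) : E3 :=
  !₂[2 * Real.arctan (Real.tanh u), 2 * v, Real.log (Real.cosh u ^ 2 + Real.sinh u ^ 2)]

/-- `μ` is a maximal solution on the open interval `J`, with values in `(-1,1)`, of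
`μ' (1 + μ²)^((k-1)/2) = (1 - μ²)^((k+1)/2)`
(maximality is expressed by `μ` taking all values in `(-1,1)`), and `P` satisfies
`P' = μ' / (1 + μ²) * ((1 + μ²) / (1 - μ²))^((k-1)/2)` on `J`. -/
structure IsGaussProfile (k : ℝ) (J : Set ℝ) (μ P : ℝ → ℝ) : Prop where
  isOpen : IsOpen J
  ordConnected : J.OrdConnected
  image_eq : μ '' J = Ioo (-1) 1
  diff : ∀ u ∈ J, DifferentiableAt ℝ μ u
  ode : ∀ u ∈ J,
    deriv μ u * (1 + μ u ^ 2) ^ ((k - 1) / 2) = (1 - μ u ^ 2) ^ ((k + 1) / 2)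
  primitive : ∀ u ∈ J, HasDerivAt P
    (deriv μ u / (1 + μ u ^ 2) * ((1 + μ u ^ 2) / (1 - μ u ^ 2)) ^ ((k - 1) / 2)) u

/-- The explicit conformal parametrization of the catenary cylinder, for `k ≠ 0, 1`. -/
def catenaryMap (k : ℝ) (μ P : ℝ → ℝ) (u v : ℝ) : E3 :=
  !₂[2 * k * P u, 2 * k * v,
    2 * k / (k - 1) * ((1 + μ u ^ 2) / (1 - μ u ^ 2)) ^ ((k - 1) / 2)]

end SingularMinimal

end

noncomputable section

namespace SingularMinimal

open Filter Topology

/-! A Gauss map with values in the line `ℝζ` means that the normal has no component in the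
horizontal direction `iζ`, so everything happens in the plane of a profile curve. Let X, Z be the
coordinates of the surface in that plane and nx, nz those of the normal. All four differentials are
multiples of one 1-form s: dX = nz s and dZ = -nx s, while the second fundamental form has rank at
most one, is therefore determined by its trace, and minimality gives dnx = -φ' nz² s and dnz = φ' nz
nx s (`chart_structure_equations`).

Hence nz e^{φ(Z)} is constant. If the constant is zero, the normal is constant, which is excluded;
otherwise nz has a fixed sign, and after replacing N by -N it is positive
(`exists_upward_cylinderData`). A second conserved quantity ties X to the angle of the normal
(`IsCylinderData.grimReaper_profile`) or to the half-angle slope nx/(1+nz)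
(`IsCylinderData.catenary_profile`). Together the two integrals put every point over one explicit
profile curve; the constants propagate by connectedness alone.

What remains is one-variable calculus in the parameter m in (-1,1). The catenary is maximal because
its slope 2m/(1-m²) takes every real value, whereas the slope of a solution never repeats a value
(`IsCatenary.maximal`). -/

/-! ### Coordinates adapted to the horizontal direction. -/

/-- The coordinate of `p` along the horizontal direction `ζ`. -/
def along (ζ : ℂ) : E3 →L[ℝ] ℝ :=
  ζ.re • EuclideanSpace.proj (0 : Fin 3) + ζ.im • EuclideanSpace.proj (1 : Fin 3)

/-- The coordinate of `p` along the horizontal direction orthogonal to `ζ`. -/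
def across (ζ : ℂ) : E3 →L[ℝ] ℝ :=
  (-ζ.im) • EuclideanSpace.proj (0 : Fin 3) + ζ.re • EuclideanSpace.proj (1 : Fin 3)

/-- The vertical coordinate. -/
def height : E3 →L[ℝ] ℝ := EuclideanSpace.proj (2 : Fin 3)

lemma along_apply (ζ : ℂ) (p : E3) : along ζ p = ζ.re * p 0 + ζ.im * p 1 := by
  simp [along]

lemma across_apply (ζ : ℂ) (p : E3) : across ζ p = -ζ.im * p 0 + ζ.re * p 1 := by
  simp [across]

lemma height_apply (p : E3) : height p = p 2 := by
  simp [height]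

lemma re_sq_add_im_sq {ζ : ℂ} (h : ‖ζ‖ = 1) : ζ.re ^ 2 + ζ.im ^ 2 = 1 := by
  have := Complex.sq_norm ζ
  rw [h, Complex.normSq_apply] at this
  nlinarith

lemma inner_eq_coords {ζ : ℂ} (h : ‖ζ‖ = 1) (p q : E3) :
    inner ℝ p q = along ζ p * along ζ q + across ζ p * across ζ q + height p * height q := by
  have h1 := re_sq_add_im_sq h
  simp only [PiLp.inner_apply, Fin.sum_univ_three, along_apply, across_apply, height_apply,
    RCLike.inner_apply, conj_trivial]
  linear_combination (-(p 0 * q 0) - p 1 * q 1) * h1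

lemma eq_zero_of_coords {ζ : ℂ} (h : ‖ζ‖ = 1) {p : E3} (h1 : along ζ p = 0)
    (h2 : across ζ p = 0) (h3 : height p = 0) : p = 0 := by
  rw [← inner_self_eq_zero (𝕜 := ℝ), inner_eq_coords h, h1, h2, h3]
  ring

/-! ### Regularity of the normal, and the trace of the shape operator. -/

/-- A continuous planar unit vector field orthogonal to a differentiable nonvanishing one is
differentiable. -/
lemma differentiableAt_planar_normal {E : Type*} [NormedAddCommGroup E] [NormedSpace ℝ E]
    {a c x z : E → ℝ} {q : E} (ha : DifferentiableAt ℝ a q) (hc : DifferentiableAt ℝ c q)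
    (hx : ContinuousAt x q) (hz : ContinuousAt z q)
    (hunit : ∀ᶠ p in 𝓝 q, x p ^ 2 + z p ^ 2 = 1)
    (horth : ∀ᶠ p in 𝓝 q, x p * a p + z p * c p = 0)
    (hne : z q * a q - x q * c q ≠ 0) :
    DifferentiableAt ℝ x q ∧ DifferentiableAt ℝ z q := by
  -- Since (x, z) is a unit normal to (a, c), s is plus or minus the length of (a, c); continuity
  -- fixes the sign near q, so s is differentiable, and x = -c/s, z = a/s.
  set s : E → ℝ := fun p => z p * a p - x p * c p with hs
  have hscont : ContinuousAt s q :=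
    (hz.mul ha.continuousAt).sub (hx.mul hc.continuousAt)
  have hsq : ∀ᶠ p in 𝓝 q, s p ^ 2 = a p ^ 2 + c p ^ 2 := by
    filter_upwards [hunit, horth] with p h1 h2
    simp only [hs]
    linear_combination (a p ^ 2 + c p ^ 2) * h1 - (x p * a p + z p * c p) * h2
  have hd : DifferentiableAt ℝ (fun p => √(a p ^ 2 + c p ^ 2)) q := by
    refine DifferentiableAt.sqrt (by fun_prop) ?_
    rw [← hsq.self_of_nhds]
    exact pow_ne_zero 2 hne
  have hsd : DifferentiableAt ℝ s q := by
    rcases lt_or_gt_of_ne hne with h | h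
    · refine hd.neg.congr_of_eventuallyEq ?_
      filter_upwards [hscont.eventually_lt continuousAt_const h, hsq] with p h1 h2
      simp only [Pi.neg_apply]
      rw [← h2, Real.sqrt_sq_eq_abs, abs_of_neg h1, neg_neg]
    · refine hd.congr_of_eventuallyEq ?_
      filter_upwards [(continuousAt_const).eventually_lt hscont h, hsq] with p h1 h2
      rw [← h2, Real.sqrt_sq_eq_abs, abs_of_pos h1]
  have hsq0 : s q ≠ 0 := hne
  have hs0 : ∀ᶠ p in 𝓝 q, s p ≠ 0 := hscont.eventually_ne hsq0
  constructor
  · refine (hc.neg.mul (hsd.inv hsq0)).congr_of_eventuallyEq ?_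
    filter_upwards [hs0, hunit, horth] with p h0 h1 h2
    simp only [Pi.neg_apply, Pi.mul_apply, Pi.inv_apply]
    rw [← div_eq_mul_inv, eq_div_iff h0]
    simp only [hs]
    linear_combination z p * h2 - c p * h1
  · refine (ha.mul (hsd.inv hsq0)).congr_of_eventuallyEq ?_
    filter_upwards [hs0, hunit, horth] with p h0 h1 h2
    simp only [Pi.mul_apply, Pi.inv_apply]
    rw [← div_eq_mul_inv, eq_div_iff h0]
    simp only [hs]
    linear_combination a p * h1 - x p * h2

lemma clm_ext_E2 {f g : E2 →L[ℝ] ℝ}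
    (h : ∀ i, f (EuclideanSpace.single i 1) = g (EuclideanSpace.single i 1)) : f = g := by
  apply ContinuousLinearMap.coe_injective
  refine (EuclideanSpace.basisFun (Fin 2) ℝ).toBasis.ext fun i => ?_
  simpa using h i

/-- The second fundamental form of a cylinder, recovered from its trace. -/
lemma shape_of_trace {s t b : Fin 2 → ℝ} {r : ℝ} (hD : s 0 * b 1 - s 1 * b 0 ≠ 0)
    (hsymm : t 0 * s 1 = t 1 * s 0)
    (htr : ∑ i, ∑ j, (Matrix.of fun i j => s i * s j + b i * b j)⁻¹ i j * (-(t i * s j)) = r)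
    (i : Fin 2) : t i = -r * s i := by
  -- Symmetry of t ⊗ s with s nonzero makes t proportional to s.
  obtain ⟨l, hl⟩ : ∃ l, ∀ i, t i = l * s i := by
    by_cases h0 : s 0 = 0
    · have h1 : s 1 ≠ 0 := by
        rintro h1
        simp [h0, h1] at hD
      refine ⟨t 1 / s 1, Fin.forall_fin_two.2 ⟨?_, ?_⟩⟩
      · rw [h0, mul_zero] at hsymm ⊢
        exact (mul_eq_zero.1 hsymm).resolve_right h1
      · field_simp
    · refine ⟨t 0 / s 0, Fin.forall_fin_two.2 ⟨by field_simp, ?_⟩⟩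
      field_simp
      linarith
  have hdet : (Matrix.of fun i j => s i * s j + b i * b j).det
      = (s 0 * b 1 - s 1 * b 0) ^ 2 := by
    rw [Matrix.det_fin_two]
    simp only [Matrix.of_apply]
    ring
  -- The inverse of the Gram matrix s ⊗ s + b ⊗ b evaluates to 1 on the pair (s, s), so the trace of
  -- -l s ⊗ s is -l.
  have : r = -l := by
    rw [← htr]
    simp only [Matrix.inv_def, hdet, Matrix.adjugate_fin_two, Fin.sum_univ_two, Matrix.smul_apply,
      Matrix.of_apply, hl, Ring.inverse_eq_inv', Matrix.cons_val', Matrix.cons_val_zero,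
      Matrix.cons_val_one, Matrix.cons_val_fin_one, smul_eq_mul]
    field_simp
    ring
  rw [hl, this]
  ring

/-- The projection is self-adjoint and fixes n. This turns the vector equation of minimality into a
scalar one by testing against the normal. -/
lemma inner_normalPart_right {X : E2 → E3} {q : E2} {n : E3}
    (hn : ∀ i, inner ℝ n (partialOne X i q) = 0) (w : E3) :
    inner ℝ (normalPart X q w) n = inner ℝ w n := by
  have hmem : n ∈ (Submodule.span ℝ (Set.range fun i => partialOne X i q))ᗮ := by
    rw [Submodule.mem_orthogonal']
    intro u hu
    induction hu using Submodule.span_induction with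
    | mem x hx => obtain ⟨i, rfl⟩ := hx; exact hn i
    | zero => simp
    | add x y _ _ hx hy => rw [inner_add_right, hx, hy, add_zero]
    | smul a x _ hx => rw [inner_smul_right, hx, mul_zero]
  rw [normalPart, Submodule.inner_starProjection_left_eq_right,
    Submodule.starProjection_eq_self_iff.2 hmem]

lemma hasDerivAt_weight {k z : ℝ} (hz : k ≠ 1 → 0 < z) :
    HasDerivAt (weight k) (if k = 1 then 1 else 2 / (k - 1) / z) z := by
  by_cases hk : k = 1
  · subst hk
    have : weight 1 = fun z => z := by ext; simp [weight]
    rw [this]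
    simpa using hasDerivAt_id' z
  · have : weight k = fun z => 2 / (k - 1) * Real.log z := by ext; simp [weight, hk]
    rw [this]
    simpa [hk, div_eq_mul_inv] using (Real.hasDerivAt_log (hz hk).ne').const_mul (2 / (k - 1))

lemma inner_gradient_weight {k : ℝ} {p : E3} (hp : p ∈ weightDomain k) (n : E3) :
    inner ℝ (gradient (fun x : E3 => weight k (x 2)) p) n
      = (if k = 1 then 1 else 2 / (k - 1) / p 2) * n 2 := by
  have h1 : HasFDerivAt (fun x : E3 => x 2) height p := by
    have : (fun x : E3 => x 2) = height := by ext; simp [height_apply]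
    rw [this]
    exact height.hasFDerivAt
  have h2 := (hasDerivAt_weight hp).comp_hasFDerivAt p h1
  rw [gradient, InnerProductSpace.toDual_symm_apply]
  erw [h2.fderiv]
  split_ifs <;> simp [height_apply]

/-! ### Structure equations of the cylinder. -/

/-- The structure equations of a weighted minimal cylinder in a parametrization. -/
lemma chart_structure_equations {k : ℝ} {ζ : ℂ} (hζ : ‖ζ‖ = 1) {X n : E2 → E3} {U : Set E2}
    (hU : IsOpen U) (hX : ContDiffOn ℝ ∞ X U) (hinj : ∀ q ∈ U, Function.Injective (fderiv ℝ X q))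
    (hdom : ∀ q ∈ U, X q ∈ weightDomain k)
    (heq : ∀ q ∈ U, meanCurvatureVector X q =
      normalPart X q (gradient (fun x : E3 => weight k (x 2)) (X q)))
    (hn : ContinuousOn n U) (hn1 : ∀ q ∈ U, ‖n q‖ = 1)
    (hno : ∀ q ∈ U, ∀ v, inner ℝ (n q) (fderiv ℝ X q v) = 0)
    (hnw : ∀ q ∈ U, across ζ (n q) = 0) {q : E2} (hq : q ∈ U) :
    ∃ s : E2 →L[ℝ] ℝ,
      HasFDerivAt (fun p => along ζ (X p)) ((n q 2) • s) q ∧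
      HasFDerivAt (fun p => X p 2) ((-along ζ (n q)) • s) q ∧
      HasFDerivAt (fun p => along ζ (n p))
        ((-((if k = 1 then 1 else 2 / (k - 1) / X q 2) * n q 2 ^ 2)) • s) q ∧
      HasFDerivAt (fun p => n p 2)
        (((if k = 1 then 1 else 2 / (k - 1) / X q 2) * n q 2 * along ζ (n q)) • s) q := by
  have hnear : ∀ᶠ p in 𝓝 q, p ∈ U := hU.mem_nhds hq
  have hXat : ContDiffAt ℝ ∞ X q := hX.contDiffAt (hU.mem_nhds hq)
  have hXd : HasFDerivAt X (fderiv ℝ X q) q := (hXat.differentiableAt (by simp)).hasFDerivAt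
  have hD2 : DifferentiableAt ℝ (fderiv ℝ X) q :=
    (hXat.fderiv_right (m := ∞) (by simp)).differentiableAt (by simp)
  set w : Fin 2 → E2 := fun i => EuclideanSpace.single i 1 with hw
  set x : E2 → ℝ := fun p => along ζ (n p) with hx
  set z : E2 → ℝ := fun p => height (n p) with hz
  have hunit : ∀ p ∈ U, x p ^ 2 + z p ^ 2 = 1 := by
    intro p hp
    have h1 := real_inner_self_eq_norm_sq (n p)
    rw [hn1 p hp, inner_eq_coords hζ, hnw p hp] at h1
    simp only [hx, hz]
    linarith
  have horth : ∀ p ∈ U, ∀ v, x p * along ζ (fderiv ℝ X p v) + z p * height (fderiv ℝ X p v)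
      = 0 := by
    intro p hp v
    have h1 := hno p hp v
    rw [inner_eq_coords hζ, hnw p hp] at h1
    simp only [hx, hz]
    linarith
  -- The pairing of the differential of X with (z, -x), the unit tangent of the profile curve.
  set s : E2 →L[ℝ] ℝ :=
    z q • (along ζ).comp (fderiv ℝ X q) - x q • height.comp (fderiv ℝ X q) with hs
  have hsv : ∀ v, s v = z q * along ζ (fderiv ℝ X q v) - x q * height (fderiv ℝ X q v) := by
    intro v; simp [hs]
  have hal : ∀ v, along ζ (fderiv ℝ X q v) = z q * s v := by
    intro v
    rw [hsv]
    linear_combination (-along ζ (fderiv ℝ X q v)) * hunit q hq + x q * horth q hq v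
  have hhe : ∀ v, height (fderiv ℝ X q v) = -x q * s v := by
    intro v
    rw [hsv]
    linear_combination (-height (fderiv ℝ X q v)) * hunit q hq + z q * horth q hq v
  set b : Fin 2 → ℝ := fun i => across ζ (fderiv ℝ X q (w i)) with hb
  have hdet : s (w 0) * b 1 - s (w 1) * b 0 ≠ 0 := by
    intro h0
    have key : ∀ r₀ r₁ : ℝ, r₀ * s (w 0) + r₁ * s (w 1) = 0 → r₀ * b 0 + r₁ * b 1 = 0 →
        r₀ = 0 ∧ r₁ = 0 := by
      intro r₀ r₁ h1 h2
      have hs0 : s (r₀ • w 0 + r₁ • w 1) = 0 := by simpa using h1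
      have : fderiv ℝ X q (r₀ • w 0 + r₁ • w 1) = 0 := by
        apply eq_zero_of_coords hζ
        · rw [hal, hs0, mul_zero]
        · simpa [hb] using h2
        · rw [hhe, hs0, mul_zero]
      have h3 : r₀ • w 0 + r₁ • w 1 = 0 := hinj q hq (by simpa using this)
      constructor
      · simpa [hw] using congrArg (fun v : E2 => v 0) h3
      · simpa [hw] using congrArg (fun v : E2 => v 1) h3
    -- If the determinant vanished, both of these would be linear relations between the columns, so
    -- s and b would be zero on the basis, and then (1, 0) would be a relation too.
    have h1 := key (s (w 1)) (-s (w 0)) (by ring) (by linarith)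
    have h2 := key (b 1) (-b 0) (by linarith) (by ring)
    have h3 := key 1 0 (by simp [neg_eq_zero.1 h1.2]) (by simp [neg_eq_zero.1 h2.2])
    exact one_ne_zero h3.1
  have hpd : ∀ (T : E3 →L[ℝ] ℝ) (v : E2), HasFDerivAt (fun p => T (fderiv ℝ X p v))
      (T.comp ((fderiv ℝ (fderiv ℝ X) q).flip v)) q := by
    intro T v
    have := T.hasFDerivAt.comp q ((ContinuousLinearMap.apply ℝ E3 v).hasFDerivAt.comp q
      hD2.hasFDerivAt)
    exact this
  have hxc : ContinuousAt x q := (along ζ).continuous.continuousAt.comp (hn.continuousAt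
    (hU.mem_nhds hq))
  have hzc : ContinuousAt z q := height.continuous.continuousAt.comp (hn.continuousAt
    (hU.mem_nhds hq))
  -- The normal is only assumed continuous; its differentiability comes from orthogonality to a
  -- tangent vector whose component s is nonzero.
  have hdiff : DifferentiableAt ℝ x q ∧ DifferentiableAt ℝ z q := by
    have : ∃ i, s (w i) ≠ 0 := by
      by_contra! h
      simp [h] at hdet
    obtain ⟨i, hi⟩ := this
    rw [hsv] at hi
    refine differentiableAt_planar_normal (hpd (along ζ) (w i)).differentiableAt
      (hpd height (w i)).differentiableAt hxc hzc ?_ ?_ hi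
    · filter_upwards [hnear] with p hp using hunit p hp
    · filter_upwards [hnear] with p hp using horth p hp _
  obtain ⟨hxd, hzd⟩ := hdiff
  set t : E2 →L[ℝ] ℝ := z q • fderiv ℝ x q - x q • fderiv ℝ z q with ht
  have hnn : ∀ v, x q * fderiv ℝ x q v + z q * fderiv ℝ z q v = 0 := by
    intro v
    have h1 : HasFDerivAt (fun p => x p ^ 2 + z p ^ 2) (0 : E2 →L[ℝ] ℝ) q := by
      refine (hasFDerivAt_const (1 : ℝ) q).congr_of_eventuallyEq ?_
      filter_upwards [hnear] with p hp using hunit p hp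
    have h2 := (hxd.hasFDerivAt.pow 2).add (hzd.hasFDerivAt.pow 2)
    have h3 := congrArg (fun f : E2 →L[ℝ] ℝ => f v) (h1.unique h2)
    simp at h3
    linarith
  have hxt : ∀ v, fderiv ℝ x q v = z q * t v := by
    intro v
    simp [ht]
    linear_combination (-fderiv ℝ x q v) * hunit q hq + x q * hnn v
  have hzt : ∀ v, fderiv ℝ z q v = -x q * t v := by
    intro v
    simp [ht]
    linear_combination (-fderiv ℝ z q v) * hunit q hq + z q * hnn v
  -- Differentiating the orthogonality relation expresses the second fundamental form as -t ⊗ s.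
  have hsecond : ∀ u v, x q * along ζ (fderiv ℝ (fderiv ℝ X) q u v) +
      z q * height (fderiv ℝ (fderiv ℝ X) q u v) = -(t u * s v) := by
    intro u v
    have h1 : HasFDerivAt (fun p => x p * along ζ (fderiv ℝ X p v) +
        z p * height (fderiv ℝ X p v)) (0 : E2 →L[ℝ] ℝ) q := by
      refine (hasFDerivAt_const (0 : ℝ) q).congr_of_eventuallyEq ?_
      filter_upwards [hnear] with p hp using horth p hp v
    have h2 := (hxd.hasFDerivAt.mul (hpd (along ζ) v)).add
      (hzd.hasFDerivAt.mul (hpd height v))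
    have h3 := congrArg (fun f : E2 →L[ℝ] ℝ => f u) (h1.unique h2)
    simp [hxt, hzt, hal, hhe] at h3
    linear_combination (-1 : ℝ) * h3 - t u * s v * hunit q hq
  have hsymm : ∀ u v, fderiv ℝ (fderiv ℝ X) q u v = fderiv ℝ (fderiv ℝ X) q v u := by
    intro u v
    exact (hXat.isSymmSndFDerivAt 
      (by simpa using WithTop.coe_le_coe.2 (le_top : (2 : ℕ∞) ≤ ⊤))) u v
  have htwo : ∀ i j, partialTwo X i j q = fderiv ℝ (fderiv ℝ X) q (w i) (w j) := by
    intro i j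
    have h1 : HasFDerivAt (partialOne X j) ((fderiv ℝ (fderiv ℝ X) q).flip (w j)) q := by
      have := (ContinuousLinearMap.apply ℝ E3 (w j)).hasFDerivAt.comp q hD2.hasFDerivAt
      exact this
    rw [partialTwo, h1.fderiv]
    rfl
  have hform : firstForm X q
      = Matrix.of fun i j => s (w i) * s (w j) + b i * b j := by
    ext i j
    simp only [firstForm, Matrix.of_apply, partialOne]
    rw [inner_eq_coords hζ]
    change along ζ (fderiv ℝ X q (w i)) * along ζ (fderiv ℝ X q (w j)) + b i * b j +
      height (fderiv ℝ X q (w i)) * height (fderiv ℝ X q (w j)) = _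
    rw [hal, hal, hhe, hhe]
    linear_combination s (w i) * s (w j) * hunit q hq
  have hnpart : ∀ i, inner ℝ (n q) (partialOne X i q) = 0 := fun i => hno q hq _
  have htrace : ∑ i, ∑ j, (Matrix.of fun i j => s (w i) * s (w j) + b i * b j)⁻¹ i j *
      (-(t (w i) * s (w j))) = (if k = 1 then 1 else 2 / (k - 1) / X q 2) * z q := by
    have h1 := congrArg (fun v : E3 => inner ℝ v (n q)) (heq q hq)
    simp only [inner_normalPart_right hnpart, inner_gradient_weight (hdom q hq)] at h1
    simp only [hz, height_apply]
    rw [← h1, meanCurvatureVector, hform, sum_inner]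
    refine Finset.sum_congr rfl fun i _ => ?_
    rw [sum_inner]
    refine Finset.sum_congr rfl fun j _ => ?_
    rw [real_inner_smul_left, inner_normalPart_right hnpart, htwo, inner_eq_coords hζ,
      hnw q hq, ← hsecond]
    simp only [hx, hz]
    ring
  have hts : t = (-((if k = 1 then 1 else 2 / (k - 1) / X q 2) * z q)) • s := by
    refine clm_ext_E2 fun i => ?_
    have h1 : t (w 0) * s (w 1) = t (w 1) * s (w 0) := by
      have h2 := hsecond (w 0) (w 1)
      rw [hsymm, hsecond] at h2
      linarith
    exact shape_of_trace (s := fun i => s (w i)) (t := fun i => t (w i)) hdet h1 htrace i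
  have hzn : ∀ p, z p = n p 2 := fun p => height_apply _
  refine ⟨s, ?_, ?_, ?_, ?_⟩
  · refine ((along ζ).hasFDerivAt.comp q hXd).congr_fderiv ?_
    ext v
    simp [hal, hzn]
  · have := height.hasFDerivAt.comp q hXd
    have e : (height ∘ X) = fun p => X p 2 := by ext p; simp [height_apply]
    rw [e] at this
    refine this.congr_fderiv ?_
    ext v
    simp [hhe, hx]
  · refine hxd.hasFDerivAt.congr_fderiv ?_
    ext v
    rw [hxt, hts]
    simp only [_root_.smul_apply, smul_eq_mul, hzn]
    ring
  · have e : (fun p => n p 2) = z := by ext p; rw [hzn]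
    rw [e]
    refine hzd.hasFDerivAt.congr_fderiv ?_
    ext v
    rw [hzt, hts]
    simp only [_root_.smul_apply, smul_eq_mul, hzn, hx]
    ring

/-- The functions `X, Z` (coordinates of the profile curve) and `nx, nz` (coordinates of its unit
normal) on `M` satisfy the structure equations of a weighted minimal cylinder. -/
structure IsCylinderData {M : Type*} [TopologicalSpace M] [ChartedSpace E2 M]
    (k : ℝ) (X Z nx nz : M → ℝ) : Prop where
  domain : ∀ p, k ≠ 1 → 0 < Z p
  unit : ∀ p, nx p ^ 2 + nz p ^ 2 = 1
  equations : ∀ p, ∀ q ∈ (chartAt E2 p).target, ∃ s : E2 →L[ℝ] ℝ,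
    HasFDerivAt (X ∘ (chartAt E2 p).symm) (nz ((chartAt E2 p).symm q) • s) q ∧
    HasFDerivAt (Z ∘ (chartAt E2 p).symm) ((-nx ((chartAt E2 p).symm q)) • s) q ∧
    HasFDerivAt (nx ∘ (chartAt E2 p).symm)
      ((-((if k = 1 then 1 else 2 / (k - 1) / Z ((chartAt E2 p).symm q)) *
        nz ((chartAt E2 p).symm q) ^ 2)) • s) q ∧
    HasFDerivAt (nz ∘ (chartAt E2 p).symm)
      (((if k = 1 then 1 else 2 / (k - 1) / Z ((chartAt E2 p).symm q)) *
        nz ((chartAt E2 p).symm q) * nx ((chartAt E2 p).symm q)) • s) q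

/-- Reversing the normal reverses the 1-form s as well, which leaves all four equations intact. -/
lemma IsCylinderData.neg {M : Type*} [TopologicalSpace M] [ChartedSpace E2 M]
    {k : ℝ} {X Z nx nz : M → ℝ} (h : IsCylinderData k X Z nx nz) :
    IsCylinderData k X Z (-nx) (-nz) where
  domain := h.domain
  unit p := by simpa using h.unit p
  equations p q hq := by
    obtain ⟨s, h1, h2, h3, h4⟩ := h.equations p q hq
    refine ⟨-s, ?_, ?_, ?_, ?_⟩
    · exact h1.congr_fderiv (by simp only [Pi.neg_apply]; module)
    · exact h2.congr_fderiv (by simp only [Pi.neg_apply]; module)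
    · exact h3.neg.congr_fderiv (by simp only [Pi.neg_apply]; module)
    · exact h4.neg.congr_fderiv (by simp only [Pi.neg_apply]; module)

/-- A surface whose unit normal is orthogonal to a fixed horizontal direction is a cylinder. -/
lemma isCylinderData_of_isWeightedMinimal {M : Type*} [TopologicalSpace M]
    [ChartedSpace E2 M] [IsManifold (𝓡 2) ∞ M] {k : ℝ} {ψ N : M → E3}
    (hψ : IsWeightedMinimal k ψ) (hN : IsUnitNormal ψ N) {ζ : ℂ} (hζ : ‖ζ‖ = 1)
    (hw : ∀ p, across ζ (N p) = 0) :
    IsCylinderData k (fun p => along ζ (ψ p)) (fun p => ψ p 2) (fun p => along ζ (N p))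
      (fun p => N p 2) where
  domain p := hψ.mem_domain p
  unit p := by
    have h1 := real_inner_self_eq_norm_sq (N p)
    rw [hN.norm_eq_one, inner_eq_coords hζ, hw p, height_apply] at h1
    linarith
  equations p q hq := by
    set e := chartAt E2 p with he
    have hmem : e ∈ IsManifold.maximalAtlas (𝓡 2) ∞ M :=
      IsManifold.chart_mem_maximalAtlas p
    have hdiff : e.MDifferentiable (𝓡 2) (𝓡 2) := by
      have : IsManifold (𝓡 2) 1 M := IsManifold.of_le (n := ∞) (by norm_num)
      exact mdifferentiable_chart p
    have hsm : ContDiffOn ℝ ∞ (ψ ∘ e.symm) e.target := by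
      rw [← contMDiffOn_iff_contDiffOn]
      exact hψ.smooth.comp_contMDiffOn (contMDiffOn_symm_of_mem_maximalAtlas hmem)
    have hfd : ∀ r ∈ e.target, fderiv ℝ (ψ ∘ e.symm) r =
        (mfderiv (𝓡 2) 𝓘(ℝ, E3) ψ (e.symm r)).comp (mfderiv (𝓡 2) (𝓡 2) e.symm r) := by
      intro r hr
      rw [← mfderiv_eq_fderiv]
      exact mfderiv_comp r (hψ.smooth.mdifferentiableAt (by simp))
        (hdiff.mdifferentiableAt_symm hr)
    refine chart_structure_equations hζ (X := ψ ∘ e.symm) (n := N ∘ e.symm) e.open_target hsm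
      ?_ (fun r _ => hψ.mem_domain _) (hψ.equation e hmem) ?_ (fun r _ => hN.norm_eq_one _) ?_
      (fun r _ => hw _) hq
    · intro r hr
      rw [hfd r hr]
      exact (hψ.immersion _).comp (hdiff.symm.mfderiv_injective hr)
    · exact hN.continuous.comp_continuousOn e.continuousOn_symm
    · intro r hr v
      rw [hfd r hr]
      exact hN.orthogonal _ _

/-! ### First integrals. -/

lemma eq_of_chart_fderiv_eq_zero {M : Type*} [TopologicalSpace M] [PreconnectedSpace M]
    [ChartedSpace E2 M] {f : M → ℝ}
    (hf : ∀ p, ∀ q ∈ (chartAt E2 p).target,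
      HasFDerivAt (f ∘ (chartAt E2 p).symm) (0 : E2 →L[ℝ] ℝ) q) (a b : M) : f a = f b := by
  have hloc : IsLocallyConstant f := by
    rw [IsLocallyConstant.iff_eventually_eq]
    intro p
    set e := chartAt E2 p with he
    have hp : p ∈ e.source := mem_chart_source E2 p
    obtain ⟨r, hr, hball⟩ := Metric.isOpen_iff.1 e.open_target (e p) (e.map_source hp)
    have h1 : ∀ᶠ y in 𝓝 p, e y ∈ Metric.ball (e p) r :=
      (e.continuousAt hp).eventually (Metric.ball_mem_nhds _ hr)
    filter_upwards [h1, e.open_source.mem_nhds hp] with y hy hys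
    have h2 := (convex_ball (e p) r).is_const_of_fderivWithin_eq_zero (𝕜 := ℝ)
      (f := f ∘ e.symm) (fun x hx => (hf p x (hball hx)).differentiableAt.differentiableWithinAt)
      (fun x hx => by
        rw [fderivWithin_of_isOpen Metric.isOpen_ball hx, (hf p x (hball hx)).fderiv])
      hy (Metric.mem_ball_self hr)
    simpa [e.left_inv hys, e.left_inv hp] using h2
  exact hloc.apply_eq_of_preconnectedSpace a b

section FirstIntegrals

variable {M : Type*} [TopologicalSpace M] [ChartedSpace E2 M] {k : ℝ} {X Z nx nz : M → ℝ}

/-- The logarithmic derivative φ' nx s of nz cancels against φ' dZ = -φ' nx s. -/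
lemma IsCylinderData.exists_mul_exp_weight_eq [ConnectedSpace M]
    (h : IsCylinderData k X Z nx nz) :
    ∃ C : ℝ, ∀ p, nz p * Real.exp (weight k (Z p)) = C := by
  obtain ⟨p₀⟩ := (inferInstance : Nonempty M)
  refine ⟨_, fun p => eq_of_chart_fderiv_eq_zero (f := fun p => nz p * Real.exp (weight k (Z p)))
    ?_ p p₀⟩
  intro p q hq
  obtain ⟨s, -, h2, -, h4⟩ := h.equations p q hq
  have h5 := (hasDerivAt_weight (h.domain ((chartAt E2 p).symm q))).comp_hasFDerivAt q h2
  refine (h4.mul h5.exp).congr_fderiv ?_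
  ext v
  simp only [Function.comp_apply, add_apply, _root_.smul_apply, smul_eq_mul, zero_apply]
  ring

lemma IsCylinderData.normal_constant_or [ConnectedSpace M]
    (h : IsCylinderData k X Z nx nz) :
    (∃ a b : ℝ, ∀ p, nx p = a ∧ nz p = b) ∨ (∀ p, 0 < nz p) ∨ ∀ p, nz p < 0 := by
  obtain ⟨C, hC⟩ := h.exists_mul_exp_weight_eq
  rcases lt_trichotomy C 0 with h0 | h0 | h0
  · refine Or.inr (Or.inr fun p => ?_)
    rw [← hC p] at h0
    exact neg_of_mul_neg_left h0 (Real.exp_pos _).le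
  · left
    obtain ⟨p₀⟩ := (inferInstance : Nonempty M)
    have hz : ∀ p, nz p = 0 := by
      intro p
      have := hC p
      rw [h0] at this
      exact (mul_eq_zero.1 this).resolve_right (Real.exp_pos _).ne'
    refine ⟨nx p₀, 0, fun p => ⟨eq_of_chart_fderiv_eq_zero (f := nx) ?_ p p₀, hz p⟩⟩
    intro p q hq
    obtain ⟨s, -, -, h3, -⟩ := h.equations p q hq
    exact h3.congr_fderiv (by simp [hz])
  · refine Or.inr (Or.inl fun p => ?_)
    rw [← hC p] at h0
    exact pos_of_mul_pos_left h0 (Real.exp_pos _).le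

/-- The angle of the normal has differential nz dnx - nx dnz = -nz s = -dX. The second identity is
the logarithm of the first integral. -/
lemma IsCylinderData.grimReaper_profile [ConnectedSpace M]
    (h : IsCylinderData 1 X Z nx nz) (hpos : ∀ p, 0 < nz p) :
    ∃ x₀ z₀ : ℝ, ∀ p, X p + Real.arctan (nx p / nz p) = x₀ ∧ Z p + Real.log (nz p) = z₀ := by
  obtain ⟨p₀⟩ := (inferInstance : Nonempty M)
  obtain ⟨C, hC⟩ := h.exists_mul_exp_weight_eq
  refine ⟨_, Real.log C, fun p => ⟨eq_of_chart_fderiv_eq_zero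
    (f := fun p => X p + Real.arctan (nx p / nz p)) ?_ p p₀, ?_⟩⟩
  · intro p q hq
    obtain ⟨s, h1, -, h3, h4⟩ := h.equations p q hq
    have hz : nz ((chartAt E2 p).symm q) ≠ 0 := (hpos _).ne'
    have hinv := (hasDerivAt_inv hz).comp_hasFDerivAt q h4
    refine (h1.add (h3.mul hinv).arctan).congr_fderiv ?_
    ext v
    have hu := h.unit ((chartAt E2 p).symm q)
    simp only [Function.comp_apply, add_apply, _root_.smul_apply, smul_eq_mul, zero_apply,
      Pi.mul_apply, if_true]
    generalize nz ((chartAt E2 p).symm q) = b at *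
    generalize nx ((chartAt E2 p).symm q) = a at *
    have : 1 + (a * b⁻¹) ^ 2 = 1 / b ^ 2 := by
      field_simp
      linarith
    rw [this]
    field_simp
    linear_combination (-(b * s v)) * hu
  · rw [← hC p, Real.log_mul (hpos p).ne' (Real.exp_pos _).ne', Real.log_exp]
    simp [weight, add_comm]

lemma IsCylinderData.slope_mem (h : IsCylinderData k X Z nx nz) {p : M} (hp : 0 < nz p) :
    nx p / (1 + nz p) ∈ Ioo (-1 : ℝ) 1 := by
  have hu := h.unit p
  rw [mem_Ioo, lt_div_iff₀ (by linarith), div_lt_iff₀ (by linarith)]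
  constructor <;> nlinarith

/-- If θ is the angle of the normal, then nx/(1+nz) = tan(θ/2), and (1-tan²)/(1+tan²) of the half
angle is cos θ = nz. -/
lemma IsCylinderData.inv_normal (h : IsCylinderData k X Z nx nz) {p : M} (hp : 0 < nz p) :
    (1 + (nx p / (1 + nz p)) ^ 2) / (1 - (nx p / (1 + nz p)) ^ 2) = 1 / nz p := by
  have hu := h.unit p
  have h1 : 1 + nz p ≠ 0 := by linarith
  have h2 : (nx p / (1 + nz p)) ^ 2 = (1 - nz p) / (1 + nz p) := by
    rw [div_pow, div_eq_div_iff (pow_ne_zero 2 h1) h1]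
    linear_combination (1 + nz p) * hu
  rw [h2]
  have h3 : (1 : ℝ) - (1 - nz p) / (1 + nz p) = 2 * nz p / (1 + nz p) := by field_simp; ring
  have h4 : (1 : ℝ) + (1 - nz p) / (1 + nz p) = 2 / (1 + nz p) := by field_simp; ring
  rw [h3, h4]
  field_simp

/-- Raising the first integral C = nz Z^{2/(k-1)} to the power (k-1)/2 gives Z, with A =
C^{(k-1)/2}. For m = nx/(1+nz) one finds dm/(1+m²) = -φ' nz s/2; as φ' = 2/((k-1)Z), multiplying by
A(k-1) times the power that equals Z/A leaves -nz s = -dX. -/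
lemma IsCylinderData.catenary_profile [ConnectedSpace M] (hk : k ≠ 1)
    (h : IsCylinderData k X Z nx nz) (hpos : ∀ p, 0 < nz p) {F : ℝ → ℝ}
    (hF : ∀ m ∈ Ioo (-1 : ℝ) 1,
      HasDerivAt F (1 / (1 + m ^ 2) * ((1 + m ^ 2) / (1 - m ^ 2)) ^ ((k - 1) / 2)) m) :
    ∃ A x₀ : ℝ, 0 < A ∧ ∀ p, X p + A * (k - 1) * F (nx p / (1 + nz p)) = x₀ ∧
      Z p = A * ((1 + (nx p / (1 + nz p)) ^ 2) / (1 - (nx p / (1 + nz p)) ^ 2)) ^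
        ((k - 1) / 2) := by
  obtain ⟨p₀⟩ := (inferInstance : Nonempty M)
  obtain ⟨C, hC⟩ := h.exists_mul_exp_weight_eq
  have hk1 : k - 1 ≠ 0 := sub_ne_zero.2 hk
  have hC0 : 0 < C := by
    rw [← hC p₀]
    exact mul_pos (hpos _) (Real.exp_pos _)
  have hZ : ∀ p, Z p = C ^ ((k - 1) / 2) *
      ((1 + (nx p / (1 + nz p)) ^ 2) / (1 - (nx p / (1 + nz p)) ^ 2)) ^ ((k - 1) / 2) := by
    intro p
    have hZp := h.domain p hk
    rw [h.inv_normal (hpos p), ← Real.mul_rpow hC0.le (one_div_pos.2 (hpos p)).le, ← hC p,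
      weight, if_neg hk]
    have : nz p * Real.exp (2 / (k - 1) * Real.log (Z p)) * (1 / nz p)
        = Z p ^ (2 / (k - 1)) := by
      rw [Real.rpow_def_of_pos hZp, mul_comm (Real.log (Z p))]
      field_simp [(hpos p).ne']
    rw [this, ← Real.rpow_mul hZp.le]
    have : 2 / (k - 1) * ((k - 1) / 2) = 1 := by field_simp
    rw [this, Real.rpow_one]
  refine ⟨C ^ ((k - 1) / 2), _, Real.rpow_pos_of_pos hC0 _, fun p =>
    ⟨eq_of_chart_fderiv_eq_zero
      (f := fun p => X p + C ^ ((k - 1) / 2) * (k - 1) * F (nx p / (1 + nz p))) ?_ p p₀, hZ p⟩⟩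
  intro p q hq
  obtain ⟨s, h1, -, h3, h4⟩ := h.equations p q hq
  set y := (chartAt E2 p).symm q with hy
  have hz : 1 + nz y ≠ 0 := by have := hpos y; linarith
  have hinv := (hasDerivAt_inv hz).comp_hasFDerivAt q (h4.const_add 1)
  have hFd := (hF _ (h.slope_mem (hpos y))).comp_hasFDerivAt q (h3.mul hinv)
  refine (h1.add (hFd.const_mul (C ^ ((k - 1) / 2) * (k - 1)))).congr_fderiv ?_
  ext v
  have hu := h.unit y
  have hZy := hZ y
  have hZpos := h.domain y hk
  have hnz := hpos y
  simp only [Function.comp_apply, add_apply, _root_.smul_apply, smul_eq_mul, zero_apply,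
    if_neg hk, ← hy]
  generalize nz y = b at *
  generalize nx y = a at *
  generalize C ^ ((k - 1) / 2) = A at *
  generalize ((1 + (a / (1 + b)) ^ 2) / (1 - (a / (1 + b)) ^ 2)) ^ ((k - 1) / 2) = H at *
  have hm : 1 + (a / (1 + b)) ^ 2 = 2 / (1 + b) := by
    field_simp
    linear_combination hu
  rw [hm, hZy]
  have hA : A ≠ 0 := by rintro rfl; simp [hZy] at hZpos
  have hH : H ≠ 0 := by rintro rfl; simp [hZy] at hZpos
  field_simp
  linear_combination (-(b * s v)) * hu

end FirstIntegrals

/-! ### Catenaries and Gauss profiles in one variable. -/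

/-- A smooth positive function on `(-1,1)` has a primitive which is a diffeomorphism onto an open
interval. -/
lemma exists_primitive_with_inverse {f : ℝ → ℝ} (hf : ContDiffOn ℝ ∞ f (Ioo (-1) 1))
    (hpos : ∀ m ∈ Ioo (-1 : ℝ) 1, 0 < f m) :
    ∃ F G : ℝ → ℝ, (∀ m ∈ Ioo (-1 : ℝ) 1, HasDerivAt F (f m) m) ∧
      ContDiffOn ℝ ∞ F (Ioo (-1) 1) ∧ IsOpen (F '' Ioo (-1) 1) ∧
      (∀ m ∈ Ioo (-1 : ℝ) 1, G (F m) = m) ∧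
      (∀ m ∈ Ioo (-1 : ℝ) 1, HasDerivAt G (f m)⁻¹ (F m)) ∧
      ContDiffOn ℝ ∞ G (F '' Ioo (-1) 1) := by
  set I : Set ℝ := Ioo (-1) 1 with hI
  have hIo : IsOpen I := isOpen_Ioo
  have h0 : (0 : ℝ) ∈ I := by constructor <;> norm_num
  set F : ℝ → ℝ := fun m => ∫ t in (0 : ℝ)..m, f t with hF
  have hFd : ∀ m ∈ I, HasDerivAt F (f m) m := by
    intro m hm
    refine intervalIntegral.integral_hasDerivAt_right ?_ ?_ ?_
    · exact (hf.continuousOn.mono (Set.ordConnected_Ioo.uIcc_subset h0 hm)).intervalIntegrable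
    · exact hf.continuousOn.stronglyMeasurableAtFilter hIo m hm
    · exact hf.continuousOn.continuousAt (hIo.mem_nhds hm)
  have hFs : ContDiffOn ℝ ∞ F I := by
    rw [contDiffOn_infty_iff_deriv_of_isOpen hIo]
    exact ⟨fun m hm => (hFd m hm).differentiableAt.differentiableWithinAt,
      hf.congr fun m hm => (hFd m hm).deriv⟩
  have hmono : StrictMonoOn F I := by
    refine strictMonoOn_of_deriv_pos (convex_Ioo _ _) hFs.continuousOn fun m hm => ?_
    rw [hIo.interior_eq] at hm
    rw [(hFd m hm).deriv]
    exact hpos m hm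
  set G : ℝ → ℝ := Function.invFunOn F I with hG
  have hGF : ∀ m ∈ I, G (F m) = m := fun m hm => hmono.injOn.leftInvOn_invFunOn hm
  have hGs : ∀ m ∈ I, ContDiffAt ℝ ∞ G (F m) := by
    intro m hm
    have hc : ContDiffAt ℝ ∞ F m := hFs.contDiffAt (hIo.mem_nhds hm)
    have hd : HasFDerivAt F ((ContinuousLinearEquiv.unitsEquivAut ℝ
        (Units.mk0 (f m) (hpos m hm).ne') : ℝ ≃L[ℝ] ℝ) : ℝ →L[ℝ] ℝ) m := by
      refine (hFd m hm).hasFDerivAt.congr_fderiv ?_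
      ext
      simp
    have hn : (∞ : WithTop ℕ∞) ≠ 0 := by simp
    have hstrict := hc.hasStrictFDerivAt' hd hn
    -- Near F m the global inverse agrees with the one from the inverse function theorem, because
    -- the latter takes values in I there.
    refine (hc.to_localInverse hd hn).congr_of_eventuallyEq ?_
    have hcont : ContinuousAt (hc.localInverse hd hn) (F m) :=
      (hc.to_localInverse hd hn).continuousAt
    have hval : hc.localInverse hd hn (F m) = m := hstrict.localInverse_apply_image
    have hmem : ∀ᶠ y in 𝓝 (F m), hc.localInverse hd hn y ∈ I :=
      hcont.eventually (by rw [hval]; exact hIo.mem_nhds hm)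
    filter_upwards [hmem, hstrict.eventually_right_inverse] with y h1 h2
    have h3 := hGF _ h1
    rwa [show F (hc.localInverse hd hn y) = y from h2] at h3
  refine ⟨F, G, hFd, hFs, ?_, hGF, ?_, ?_⟩
  · rw [isOpen_iff_mem_nhds]
    rintro _ ⟨m, hm, rfl⟩
    have hc : HasStrictDerivAt F (f m) m :=
      (hFs.contDiffAt (hIo.mem_nhds hm)).hasStrictDerivAt' (hFd m hm) (by simp)
    rw [← hc.map_nhds_eq (hpos m hm).ne']
    exact image_mem_map (hIo.mem_nhds hm)
  · intro m hm
    have h1 := ((hGs m hm).differentiableAt (by simp)).hasDerivAt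
    have h2 := h1.comp m (hFd m hm)
    have h3 : HasDerivAt (G ∘ F) 1 m := by
      refine (hasDerivAt_id m).congr_of_eventuallyEq ?_
      filter_upwards [hIo.mem_nhds hm] with x hx using hGF x hx
    rwa [eq_inv_of_mul_eq_one_left (h2.unique h3)] at h1
  · rintro _ ⟨m, hm, rfl⟩
    exact (hGs m hm).contDiffWithinAt

lemma one_sub_sq_pos {m : ℝ} (hm : m ∈ Ioo (-1 : ℝ) 1) : 0 < 1 - m ^ 2 := by
  nlinarith [hm.1, hm.2]

lemma contDiffOn_profile_height (a : ℝ) :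
    ContDiffOn ℝ ∞ (fun m : ℝ => ((1 + m ^ 2) / (1 - m ^ 2)) ^ a) (Ioo (-1) 1) := by
  refine ContDiffOn.rpow_const_of_ne (ContDiffOn.div (by fun_prop) (by fun_prop) ?_) ?_
  · intro m hm
    exact (one_sub_sq_pos hm).ne'
  · intro m hm
    have := one_sub_sq_pos hm
    positivity

lemma hasDerivAt_profile_height (a : ℝ) {m : ℝ} (hm : m ∈ Ioo (-1 : ℝ) 1) :
    HasDerivAt (fun m : ℝ => ((1 + m ^ 2) / (1 - m ^ 2)) ^ a)
      (((1 + m ^ 2) / (1 - m ^ 2)) ^ a * (4 * a * m / ((1 + m ^ 2) * (1 - m ^ 2)))) m := by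
  have h1 := one_sub_sq_pos hm
  have h2 : 0 < (1 + m ^ 2) / (1 - m ^ 2) := by positivity
  have h3 : HasDerivAt (fun m : ℝ => (1 + m ^ 2) / (1 - m ^ 2)) (4 * m / (1 - m ^ 2) ^ 2) m := by
    have := (((hasDerivAt_id' m).pow 2).const_add 1).div
      (((hasDerivAt_id' m).pow 2).const_sub 1) h1.ne'
    refine this.congr_deriv ?_
    simp
    ring
  refine (h3.rpow_const (p := a) (Or.inl h2.ne')).congr_deriv ?_
  rw [Real.rpow_sub_one h2.ne']
  have h4 : 1 + m ^ 2 ≠ 0 := by positivity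
  field_simp

/-- The half-angle formula m = t/(1+√(1+t²)) inverts the tangent duplication formula. -/
lemma exists_slope_eq (t : ℝ) : ∃ m ∈ Ioo (-1 : ℝ) 1, 2 * m / (1 - m ^ 2) = t := by
  set r := √(1 + t ^ 2) with hr
  have hr2 : r ^ 2 = 1 + t ^ 2 := Real.sq_sqrt (by positivity)
  have hr0 : 0 ≤ r := Real.sqrt_nonneg _
  have h1 : (0 : ℝ) < 1 + r := by linarith
  have hm : (t / (1 + r)) ^ 2 = (r - 1) / (1 + r) := by
    field_simp
    linear_combination -hr2
  have h2 : 1 - (t / (1 + r)) ^ 2 = 2 / (1 + r) := by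
    rw [hm]
    field_simp
    ring
  refine ⟨t / (1 + r), abs_lt.1 ((sq_lt_one_iff_abs_lt_one _).1 ?_), ?_⟩
  · have : (0 : ℝ) < 2 / (1 + r) := by positivity
    linarith
  · rw [h2]
    field_simp

/-- A catenary whose slope takes all real values is a maximal solution. -/
lemma IsCatenary.maximal {α : ℝ} (hα : α ≠ 0) {J : Set ℝ} {f : ℝ → ℝ} (hJ : IsOpen J)
    (hsurj : ∀ t, ∃ x ∈ J, deriv f x = t) {J' : Set ℝ} {g : ℝ → ℝ}
    (hg : IsCatenary α J' g) (hsub : J ⊆ J') (heq : EqOn f g J) : J' = J := by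
  -- By Rolle a repeated slope would give a zero of g'', which the equation forbids as α ≠ 0. A
  -- point of J' outside J would repeat a slope already attained in J.
  have hinj : ∀ x ∈ J', ∀ y ∈ J', x < y → deriv g x ≠ deriv g y := by
    intro x hx y hy hxy he
    have hIcc : Icc x y ⊆ J' := hg.ordConnected.out hx hy
    obtain ⟨c, hc, h0⟩ := exists_deriv_eq_zero hxy
      (fun z hz => (hg.diff_deriv z (hIcc hz)).continuousAt.continuousWithinAt) he
    have h1 := hg.ode c (hIcc (Ioo_subset_Icc_self hc))
    rw [h0, zero_div] at h1
    exact div_ne_zero hα (hg.pos c (hIcc (Ioo_subset_Icc_self hc))).ne' h1.symm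
  refine Subset.antisymm (fun y hy => ?_) hsub
  obtain ⟨x, hx, hxy⟩ := hsurj (deriv g y)
  have h1 : deriv g x = deriv g y := by
    rw [← hxy]
    exact ((heq.eventuallyEq_of_mem (hJ.mem_nhds hx)).deriv_eq).symm
  rcases lt_trichotomy x y with h | h | h
  · exact absurd h1 (hinj x (hsub hx) y hy h)
  · exact h ▸ hx
  · exact absurd h1.symm (hinj y hy x (hsub hx) h)

/-- The catenary described by its slope parameter `m`. -/
lemma exists_catenary {k : ℝ} (hk : k ≠ 1) {F G : ℝ → ℝ}
    (hF : ∀ m ∈ Ioo (-1 : ℝ) 1,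
      HasDerivAt F (1 / (1 + m ^ 2) * ((1 + m ^ 2) / (1 - m ^ 2)) ^ ((k - 1) / 2)) m)
    (hopen : IsOpen (F '' Ioo (-1) 1)) (hGF : ∀ m ∈ Ioo (-1 : ℝ) 1, G (F m) = m)
    (hG : ∀ m ∈ Ioo (-1 : ℝ) 1,
      HasDerivAt G (1 / (1 + m ^ 2) * ((1 + m ^ 2) / (1 - m ^ 2)) ^ ((k - 1) / 2))⁻¹ (F m))
    {A : ℝ} (hA : 0 < A) (x₀ : ℝ) :
    ∃ f : ℝ → ℝ,
      IsCatenary (2 / (k - 1)) ((fun m => A * (k - 1) * F m - x₀) '' Ioo (-1) 1) f ∧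
      (∀ (J' : Set ℝ) (g : ℝ → ℝ), IsCatenary (2 / (k - 1)) J' g →
        (fun m => A * (k - 1) * F m - x₀) '' Ioo (-1) 1 ⊆ J' →
        EqOn f g ((fun m => A * (k - 1) * F m - x₀) '' Ioo (-1) 1) →
        J' = (fun m => A * (k - 1) * F m - x₀) '' Ioo (-1) 1) ∧
      ∀ m ∈ Ioo (-1 : ℝ) 1, f (A * (k - 1) * F m - x₀) =
        A * ((1 + m ^ 2) / (1 - m ^ 2)) ^ ((k - 1) / 2) := by
  have hk1 : k - 1 ≠ 0 := sub_ne_zero.2 hk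
  have hκ : A * (k - 1) ≠ 0 := mul_ne_zero hA.ne' hk1
  set J : Set ℝ := (fun m => A * (k - 1) * F m - x₀) '' Ioo (-1) 1 with hJ
  have hJ' : J = (fun x => (x + x₀) / (A * (k - 1))) ⁻¹' (F '' Ioo (-1) 1) := by
    ext x
    constructor
    · rintro ⟨m, hm, rfl⟩
      exact ⟨m, hm, by field_simp; ring⟩
    · rintro ⟨m, hm, h⟩
      refine ⟨m, hm, ?_⟩
      simp only [h]
      field_simp
      ring
  have hJo : IsOpen J := by
    rw [hJ']
    exact hopen.preimage (by fun_prop)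
  have hJc : J.OrdConnected := by
    refine (isPreconnected_Ioo.image _ ?_).ordConnected
    exact (continuousOn_const.mul fun m hm => (hF m hm).continuousAt.continuousWithinAt).sub
      continuousOn_const
  -- The slope parameter m recovered from the abscissa x = A(k-1)F(m) - x₀.
  set g : ℝ → ℝ := fun x => G ((x + x₀) / (A * (k - 1))) with hg
  have hgx : ∀ m ∈ Ioo (-1 : ℝ) 1, g (A * (k - 1) * F m - x₀) = m := by
    intro m hm
    have : (A * (k - 1) * F m - x₀ + x₀) / (A * (k - 1)) = F m := by field_simp; ring
    simp only [hg, this, hGF m hm]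
  have hgd : ∀ m ∈ Ioo (-1 : ℝ) 1, HasDerivAt g ((1 + m ^ 2) /
      (A * (k - 1) * ((1 + m ^ 2) / (1 - m ^ 2)) ^ ((k - 1) / 2)))
      (A * (k - 1) * F m - x₀) := by
    intro m hm
    have h1 : HasDerivAt (fun x => (x + x₀) / (A * (k - 1))) (1 / (A * (k - 1)))
        (A * (k - 1) * F m - x₀) := ((hasDerivAt_id' _).add_const x₀).div_const _
    have h2 : (A * (k - 1) * F m - x₀ + x₀) / (A * (k - 1)) = F m := by field_simp; ring
    have h3 := hG m hm
    rw [← h2] at h3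
    refine (HasDerivAt.comp (h := fun x => (x + x₀) / (A * (k - 1))) _ h3 h1).congr_deriv ?_
    have h4 := one_sub_sq_pos hm
    have h5 : 0 < ((1 + m ^ 2) / (1 - m ^ 2)) ^ ((k - 1) / 2) := by positivity
    field_simp
  set f : ℝ → ℝ := fun x => A * ((1 + g x ^ 2) / (1 - g x ^ 2)) ^ ((k - 1) / 2) with hf
  have hfd : ∀ m ∈ Ioo (-1 : ℝ) 1, HasDerivAt f (2 * m / (1 - m ^ 2))
      (A * (k - 1) * F m - x₀) := by
    intro m hm
    have h3 := hasDerivAt_profile_height ((k - 1) / 2) hm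
    rw [← hgx m hm] at h3
    refine ((h3.comp _ (hgd m hm)).const_mul A).congr_deriv ?_
    rw [hgx m hm]
    have h4 := one_sub_sq_pos hm
    have h5 : 0 < ((1 + m ^ 2) / (1 - m ^ 2)) ^ ((k - 1) / 2) := by positivity
    have h6 : 0 < 1 + m ^ 2 := by positivity
    field_simp
    norm_num
  have hfdd : ∀ m ∈ Ioo (-1 : ℝ) 1, HasDerivAt (deriv f)
      (2 * (1 + m ^ 2) / (1 - m ^ 2) ^ 2 * ((1 + m ^ 2) /
      (A * (k - 1) * ((1 + m ^ 2) / (1 - m ^ 2)) ^ ((k - 1) / 2))))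
      (A * (k - 1) * F m - x₀) := by
    intro m hm
    have h4 := one_sub_sq_pos hm
    have h1 : HasDerivAt (fun m : ℝ => 2 * m / (1 - m ^ 2))
        (2 * (1 + m ^ 2) / (1 - m ^ 2) ^ 2) m := by
      refine (((hasDerivAt_id' m).const_mul 2).div
        (((hasDerivAt_id' m).pow 2).const_sub 1) h4.ne').congr_deriv ?_
      simp
      ring
    rw [← hgx m hm] at h1
    have h2 := h1.comp _ (hgd m hm)
    rw [hgx m hm] at h2
    refine h2.congr_of_eventuallyEq ?_
    filter_upwards [hJo.mem_nhds ⟨m, hm, rfl⟩]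
    rintro _ ⟨l, hl, rfl⟩
    simp only [Function.comp_apply, hgx l hl, (hfd l hl).deriv]
  have hval : ∀ m ∈ Ioo (-1 : ℝ) 1, f (A * (k - 1) * F m - x₀) =
      A * ((1 + m ^ 2) / (1 - m ^ 2)) ^ ((k - 1) / 2) := by
    intro m hm
    simp only [hf, hgx m hm]
  refine ⟨f, ⟨hJo, hJc, ⟨_, 0, by constructor <;> norm_num, rfl⟩, ?_, ?_, ?_, ?_⟩, ?_, hval⟩
  · rintro _ ⟨m, hm, rfl⟩
    have h4 := one_sub_sq_pos hm
    simp only [hval m hm]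
    positivity
  · rintro _ ⟨m, hm, rfl⟩
    exact (hfd m hm).differentiableAt
  · rintro _ ⟨m, hm, rfl⟩
    exact (hfdd m hm).differentiableAt
  · rintro _ ⟨m, hm, rfl⟩
    simp only [hval m hm, (hfd m hm).deriv, (hfdd m hm).deriv]
    have h4 := one_sub_sq_pos hm
    have h5 : 0 < ((1 + m ^ 2) / (1 - m ^ 2)) ^ ((k - 1) / 2) := by positivity
    generalize ((1 + m ^ 2) / (1 - m ^ 2)) ^ ((k - 1) / 2) = H at *
    have h6 : 1 + (2 * m / (1 - m ^ 2)) ^ 2 = (1 + m ^ 2) ^ 2 / (1 - m ^ 2) ^ 2 := by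
      field_simp
      ring
    have h7 : 0 < 1 + m ^ 2 := by positivity
    rw [h6]
    field_simp
  · intro J' g' hg' hsub heq
    refine IsCatenary.maximal (div_ne_zero two_ne_zero hk1) hJo (fun t => ?_) hg' hsub heq
    obtain ⟨m, hm, h⟩ := exists_slope_eq t
    exact ⟨_, ⟨m, hm, rfl⟩, by rw [(hfd m hm).deriv, h]⟩

/-- The profile of the Gauss map, with a smooth change of parameter `U` to the slope. -/
lemma exists_gaussProfile (k : ℝ) {F : ℝ → ℝ}
    (hF : ∀ m ∈ Ioo (-1 : ℝ) 1,
      HasDerivAt F (1 / (1 + m ^ 2) * ((1 + m ^ 2) / (1 - m ^ 2)) ^ ((k - 1) / 2)) m) :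
    ∃ U μ : ℝ → ℝ, IsGaussProfile k (U '' Ioo (-1) 1) μ (F ∘ μ) ∧
      ContDiffOn ℝ ∞ U (Ioo (-1) 1) ∧ ∀ m ∈ Ioo (-1 : ℝ) 1, μ (U m) = m := by
  have hsm : ContDiffOn ℝ ∞ (fun m : ℝ => (1 + m ^ 2) ^ ((k - 1) / 2) / (1 - m ^ 2) ^ ((k + 1) / 2))
      (Ioo (-1) 1) := by
    refine ContDiffOn.div (ContDiffOn.rpow_const_of_ne (by fun_prop) fun m hm => by positivity)
      (ContDiffOn.rpow_const_of_ne (by fun_prop) fun m hm => (one_sub_sq_pos hm).ne') ?_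
    intro m hm
    exact (Real.rpow_pos_of_pos (one_sub_sq_pos hm) _).ne'
  -- The equation for μ is separable: U integrates du/dm, and μ is its inverse.
  obtain ⟨U, μ, hU, hUs, hopen, hμU, hμ, -⟩ := exists_primitive_with_inverse hsm (fun m hm =>
    div_pos (by positivity) (Real.rpow_pos_of_pos (one_sub_sq_pos hm) _))
  refine ⟨U, μ, ⟨hopen, ?_, ?_, ?_, ?_, ?_⟩, hUs, hμU⟩
  · exact (isPreconnected_Ioo.image _ hUs.continuousOn).ordConnected
  · rw [image_image]
    ext m
    constructor
    · rintro ⟨l, hl, rfl⟩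
      simpa only [hμU l hl] using hl
    · exact fun hm => ⟨m, hm, hμU m hm⟩
  · rintro _ ⟨m, hm, rfl⟩
    exact (hμ m hm).differentiableAt
  · rintro _ ⟨m, hm, rfl⟩
    rw [(hμ m hm).deriv, hμU m hm]
    have h1 := Real.rpow_pos_of_pos (one_sub_sq_pos hm) ((k + 1) / 2)
    have h2 : 0 < (1 + m ^ 2) ^ ((k - 1) / 2) := by positivity
    field_simp
  · rintro _ ⟨m, hm, rfl⟩
    have h1 := hF m hm
    rw [← hμU m hm] at h1
    have h2 := h1.comp _ (hμ m hm)
    refine h2.congr_deriv ?_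
    rw [(hμ m hm).deriv, hμU m hm]
    ring

/-! ### Vertical rotations and the grim reaper parameter. -/

lemma verticalRotation_add (τ : ℂ) (p q : E3) :
    verticalRotation τ (p + q) = verticalRotation τ p + verticalRotation τ q := by
  ext i
  fin_cases i <;> simp [verticalRotation] <;> ring

lemma verticalRotation_smul (τ : ℂ) (c : ℝ) (p : E3) :
    verticalRotation τ (c • p) = c • verticalRotation τ p := by
  ext i
  fin_cases i <;> simp [verticalRotation] <;> ring

/-- The adapted coordinates form the complex number conj(ζ)(x+iy); the rotation by -ζ accounts for
the two minus signs. -/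
lemma verticalRotation_coords {ζ : ℂ} (hζ : ‖ζ‖ = 1) (p : E3) :
    verticalRotation (-ζ) !₂[-along ζ p, -across ζ p, p 2] = p := by
  have h := re_sq_add_im_sq hζ
  ext i
  fin_cases i
  · simp [verticalRotation, along_apply, across_apply]
    linear_combination p 0 * h
  · simp [verticalRotation, along_apply, across_apply]
    linear_combination p 1 * h
  · simp [verticalRotation]

lemma tan_half_eq {θ : ℝ} (h : θ ∈ Ioo (-(π / 2)) (π / 2)) :
    Real.tan (θ / 2) = Real.sin θ / (1 + Real.cos θ) := by
  have hc : 0 < Real.cos (θ / 2) := Real.cos_pos_of_mem_Ioo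
    ⟨by linarith [h.1, Real.pi_pos], by linarith [h.2, Real.pi_pos]⟩
  have h1 : Real.sin θ = 2 * Real.sin (θ / 2) * Real.cos (θ / 2) := by
    rw [← Real.sin_two_mul]; ring_nf
  have h2 : Real.cos θ = 2 * Real.cos (θ / 2) ^ 2 - 1 := by
    rw [← Real.cos_two_mul]; ring_nf
  rw [h1, h2, Real.tan_eq_sin_div_cos]
  field_simp
  ring

/-- Parametrization of the grim reaper curve by half of the inverse Gudermannian function. -/
lemma grimReaper_parameter {θ : ℝ} (h : θ ∈ Ioo (-(π / 2)) (π / 2)) :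
    Real.tanh (Real.arsinh (Real.tan θ) / 2) = Real.sin θ / (1 + Real.cos θ) ∧
    2 * Real.arctan (Real.tanh (Real.arsinh (Real.tan θ) / 2)) = θ ∧
    Real.log (Real.cosh (Real.arsinh (Real.tan θ) / 2) ^ 2 +
      Real.sinh (Real.arsinh (Real.tan θ) / 2) ^ 2) = -Real.log (Real.cos θ) := by
  have hc : 0 < Real.cos θ := Real.cos_pos_of_mem_Ioo h
  -- Chosen so that sinh 2u = tan θ, hence cosh 2u = 1/cos θ and tanh u = tan(θ/2).
  set u := Real.arsinh (Real.tan θ) / 2 with hu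
  have h2u : 2 * u = Real.arsinh (Real.tan θ) := by rw [hu]; ring
  have hs : 2 * Real.sinh u * Real.cosh u = Real.tan θ := by
    rw [← Real.sinh_two_mul, h2u, Real.sinh_arsinh]
  have hch : Real.cosh u ^ 2 + Real.sinh u ^ 2 = (Real.cos θ)⁻¹ := by
    rw [← Real.cosh_two_mul, h2u, Real.cosh_arsinh, ← Real.inv_sqrt_one_add_tan_sq hc, inv_inv]
  have hcu := Real.cosh_pos u
  have h1 : Real.tanh u = Real.sin θ / (1 + Real.cos θ) := by
    have h3 : 2 * Real.cosh u ^ 2 = (1 + Real.cos θ) / Real.cos θ := by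
      have := Real.cosh_sq u
      have h4 : (1 + Real.cos θ) / Real.cos θ = (Real.cos θ)⁻¹ + 1 := by field_simp
      rw [h4]
      linarith
    have h5 : Real.tanh u = (2 * Real.sinh u * Real.cosh u) / (2 * Real.cosh u ^ 2) := by
      rw [Real.tanh_eq_sinh_div_cosh]
      field_simp
    rw [h5, hs, h3, Real.tan_eq_sin_div_cos]
    have : 1 + Real.cos θ ≠ 0 := by linarith
    field_simp
  refine ⟨h1, ?_, ?_⟩
  · rw [h1, ← tan_half_eq h, Real.arctan_tan (by linarith [h.1, Real.pi_pos])
      (by linarith [h.2, Real.pi_pos])]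
    ring
  · rw [hch, Real.log_inv]

lemma exists_grimReaper_parameter (s : ℝ) :
    2 * Real.arctan (Real.tanh s) ∈ Ioo (-(π / 2)) (π / 2) ∧
    Real.log (Real.cosh s ^ 2 + Real.sinh s ^ 2) =
      -Real.log (Real.cos (2 * Real.arctan (Real.tanh s))) := by
  have h1 : 2 * Real.arctan (Real.tanh s) ∈ Ioo (-(π / 2)) (π / 2) := by
    have h2 := Real.arctan_strictMono (Real.tanh_lt_one s)
    have h3 := Real.arctan_strictMono (Real.neg_one_lt_tanh s)
    rw [Real.arctan_neg] at h3
    rw [Real.arctan_one] at h2 h3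
    constructor <;> linarith
  refine ⟨h1, ?_⟩
  obtain ⟨-, h2, h3⟩ := grimReaper_parameter h1
  have h4 : Real.arsinh (Real.tan (2 * Real.arctan (Real.tanh s))) / 2 = s :=
    Real.tanh_injective (Real.arctan_injective (by linarith))
  rwa [h4] at h3

/-! ### From the Gauss map to the cylinders. -/

lemma normal_eq_of_southStereo {n : E3} {ζ : ℂ} (hζ : ‖ζ‖ = 1) {m : ℝ} (hn : n 2 ≠ -1)
    (h : southStereo n = ζ * (m : ℂ)) : across ζ n = 0 ∧ along ζ n = m * (1 + n 2) := by
  have h1 : 1 + n 2 ≠ 0 := fun h0 => hn (by linarith)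
  rw [southStereo, div_eq_iff (Complex.ofReal_ne_zero.2 h1)] at h
  have hre := congrArg Complex.re h
  have him := congrArg Complex.im h
  simp at hre him
  have h2 := re_sq_add_im_sq hζ
  rw [across_apply, along_apply, hre, him]
  constructor
  · ring
  · linear_combination (m * (1 + n 2)) * h2

/-- Up to the choice of the unit normal, a weighted minimal surface whose Gauss map takes values
in a line and is not constant has an upward unit normal. -/
lemma exists_upward_cylinderData {M : Type*} [TopologicalSpace M] [ConnectedSpace M]
    [ChartedSpace E2 M] [IsManifold (𝓡 2) ∞ M] {k : ℝ} {ψ N : M → E3}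
    (hψ : IsWeightedMinimal k ψ) (hN : IsUnitNormal ψ N) (hfin : ∀ p, N p 2 ≠ -1)
    {ζ : ℂ} (hζ : ‖ζ‖ = 1) {m : M → ℝ} (hG : ∀ p, southStereo (N p) = ζ * (m p : ℂ))
    (hnc : ¬ ∃ c : ℂ, ∀ p, southStereo (N p) = c) :
    ∃ a b : M → ℝ, IsCylinderData k (fun p => along ζ (ψ p)) (fun p => ψ p 2) a b ∧
      (∀ p, 0 < b p) ∧ ∀ p, |m p| < 1 → m p = a p / (1 + b p) := by
  have hn := fun p => normal_eq_of_southStereo hζ (hfin p) (hG p)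
  have hD := isCylinderData_of_isWeightedMinimal hψ hN hζ fun p => (hn p).1
  have h0 : ∀ p, 1 + N p 2 ≠ 0 := fun p h0 => hfin p (by linarith)
  have hm : ∀ p, m p = along ζ (N p) / (1 + N p 2) := by
    intro p
    rw [(hn p).2, mul_div_cancel_right₀ _ (h0 p)]
  rcases hD.normal_constant_or with ⟨a, b, hab⟩ | hpos | hneg
  · refine absurd ⟨ζ * ((a / (1 + b) : ℝ) : ℂ), fun p => ?_⟩ hnc
    rw [hG p, hm p, (hab p).1, (hab p).2]
  · exact ⟨_, _, hD, hpos, fun p _ => hm p⟩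
  -- For a downward normal m² = (1-N₃)/(1+N₃) > 1, so after the change of sign the claim about |m| <
  -- 1 is vacuous.
  · refine ⟨_, _, hD.neg, fun p => neg_pos.2 (hneg p), fun p hp => ?_⟩
    exfalso
    have h1 := hD.unit p
    have h2 := hneg p
    have h3 := (sq_lt_one_iff_abs_lt_one _).2 hp
    simp only [(hn p).2] at h1
    have h4 : (1 + N p 2) * (m p ^ 2 * (1 + N p 2) - (1 - N p 2)) = 0 := by
      linear_combination h1
    have h5 := (mul_eq_zero.1 h4).resolve_left (h0 p)
    have h6 : -1 < N p 2 := by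
      have : N p 2 ^ 2 ≤ 1 := by nlinarith [sq_nonneg (m p * (1 + N p 2))]
      exact lt_of_le_of_ne (by nlinarith) (Ne.symm (hfin p))
    nlinarith

lemma range_subset_grimReaperCylinder {M : Type*} [TopologicalSpace M] [ConnectedSpace M]
    [ChartedSpace E2 M] [IsManifold (𝓡 2) ∞ M] {ψ N : M → E3}
    (hψ : IsWeightedMinimal 1 ψ) (hN : IsUnitNormal ψ N) (hfin : ∀ p, N p 2 ≠ -1)
    {ζ : ℂ} (hζ : ‖ζ‖ = 1) {m : M → ℝ} (hG : ∀ p, southStereo (N p) = ζ * (m p : ℂ))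
    (hnc : ¬ ∃ c : ℂ, ∀ p, southStereo (N p) = c) :
    ∃ (S : Set E3) (b : E3) (u v : M → ℝ),
        IsGrimReaperCylinder S ∧ Set.range ψ ⊆ S ∧
        S = {q | ∃ s t : ℝ, q = b + verticalRotation (-ζ) (grimReaperMap s t)} ∧
        ContMDiff (𝓡 2) 𝓘(ℝ, ℝ) ∞ u ∧ ContMDiff (𝓡 2) 𝓘(ℝ, ℝ) ∞ v ∧
        (∀ p, ψ p = b + verticalRotation (-ζ) (grimReaperMap (u p) (v p))) ∧
        (∀ p, |m p| < 1 → m p = Real.tanh (u p)) := by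
  obtain ⟨a, b, hD, hpos, hm⟩ := exists_upward_cylinderData hψ hN hfin hζ hG hnc
  obtain ⟨x₀, z₀, hxz⟩ := hD.grimReaper_profile hpos
  -- The angle of the normal, written through ψ rather than N so that smoothness of u follows from
  -- that of ψ.
  set θ : M → ℝ := fun p => x₀ - along ζ (ψ p) with hθ
  have hθa : ∀ p, θ p = Real.arctan (a p / b p) := by
    intro p
    rw [hθ, ← (hxz p).1]
    ring
  have hmem : ∀ p, θ p ∈ Ioo (-(π / 2)) (π / 2) := by
    intro p
    rw [hθa]
    exact Real.arctan_mem_Ioo _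
  have hsq : ∀ p, √(1 + (a p / b p) ^ 2) = 1 / b p := by
    intro p
    have h1 := hpos p
    rw [Real.sqrt_eq_iff_mul_self_eq (by positivity) (by positivity)]
    field_simp
    linarith [hD.unit p]
  have hcos : ∀ p, Real.cos (θ p) = b p := by
    intro p
    rw [hθa, Real.cos_arctan, hsq, one_div_one_div]
  have hsin : ∀ p, Real.sin (θ p) = a p := by
    intro p
    have := (hpos p).ne'
    rw [hθa, Real.sin_arctan, hsq]
    field_simp
  set B : E3 := verticalRotation (-ζ) !₂[-x₀, 0, z₀] with hB
  set u : M → ℝ := fun p => Real.arsinh (Real.tan (θ p)) / 2 with hu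
  set v : M → ℝ := fun p => -across ζ (ψ p) / 2 with hv
  have hpar : ∀ p, ψ p = B + verticalRotation (-ζ) (grimReaperMap (u p) (v p)) := by
    intro p
    obtain ⟨-, h2, h3⟩ := grimReaper_parameter (hmem p)
    rw [hB, ← verticalRotation_add]
    conv_lhs => rw [← verticalRotation_coords hζ (ψ p)]
    congr 1
    ext i
    fin_cases i
    · simp [grimReaperMap, hu, h2]
      simp [hθ]
      ring
    · simp [grimReaperMap, hv]
      ring
    · have := (hxz p).2
      simp [grimReaperMap, hu, h3, hcos]
      linarith
  refine ⟨_, B, u, v, ?_, ?_, rfl, ?_, ?_, hpar, ?_⟩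
  · refine ⟨-ζ, B, by rw [norm_neg, hζ], ?_⟩
    ext q
    constructor
    · rintro ⟨s, t, rfl⟩
      obtain ⟨h1, h2⟩ := exists_grimReaper_parameter s
      exact ⟨grimReaperMap s t, ⟨by simpa [grimReaperMap] using h1,
        by simpa [grimReaperMap] using h2⟩, rfl⟩
    · rintro ⟨p, ⟨h1, h2⟩, rfl⟩
      obtain ⟨-, h3, h4⟩ := grimReaper_parameter h1
      refine ⟨Real.arsinh (Real.tan (p 0)) / 2, p 1 / 2, ?_⟩
      simp only
      congr 2
      ext i
      fin_cases i
      · simp [grimReaperMap, h3]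
      · simp [grimReaperMap]
        ring
      · simp [grimReaperMap, h4, h2]
  · rintro _ ⟨p, rfl⟩
    exact ⟨u p, v p, hpar p⟩
  · intro p
    have h1 : ContMDiffAt (𝓡 2) 𝓘(ℝ, ℝ) ∞ (fun p => along ζ (ψ p)) p :=
      (along ζ).contMDiff.contMDiffAt.comp p (hψ.smooth p)
    have h2 : ContDiffAt ℝ ∞ (fun x : ℝ => Real.arsinh (Real.tan (x₀ - x)) / 2)
        (along ζ (ψ p)) := by
      have h3 : ContDiffAt ℝ ∞ Real.tan (x₀ - along ζ (ψ p)) :=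
        Real.contDiffAt_tan.2 (Real.cos_pos_of_mem_Ioo (hmem p)).ne'
      exact ((h3.comp (along ζ (ψ p)) (by fun_prop)).arsinh).div_const 2
    exact h2.contMDiffAt.comp p h1
  · have h1 : ContMDiff (𝓡 2) 𝓘(ℝ, ℝ) ∞ (fun p => across ζ (ψ p)) :=
      (across ζ).contMDiff.comp hψ.smooth
    have h2 : ContDiff ℝ ∞ (fun x : ℝ => -x / 2) := by fun_prop
    exact h2.contMDiff.comp h1
  · intro p hp
    rw [hm p hp, hu, (grimReaper_parameter (hmem p)).1, hsin, hcos]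

lemma range_subset_catenaryCylinder {M : Type*} [TopologicalSpace M] [ConnectedSpace M]
    [ChartedSpace E2 M] [IsManifold (𝓡 2) ∞ M] {k : ℝ} (hk : k ≠ 0) (hk1 : k ≠ 1) {ψ N : M → E3}
    (hψ : IsWeightedMinimal k ψ) (hN : IsUnitNormal ψ N) (hfin : ∀ p, N p 2 ≠ -1)
    {ζ : ℂ} (hζ : ‖ζ‖ = 1) {m : M → ℝ} (hG : ∀ p, southStereo (N p) = ζ * (m p : ℂ))
    (hnc : ¬ ∃ c : ℂ, ∀ p, southStereo (N p) = c) :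
    ∃ (S : Set E3) (J : Set ℝ) (μ P : ℝ → ℝ) (c : ℝ) (b : E3) (u v : M → ℝ),
        IsCatenaryCylinder (2 / (k - 1)) S ∧ Set.range ψ ⊆ S ∧
        IsGaussProfile k J μ P ∧ 0 < c * (k / (k - 1)) ∧ b 2 = 0 ∧
        S = {q | ∃ s ∈ J, ∃ t : ℝ, q = b + c • verticalRotation (-ζ) (catenaryMap k μ P s t)} ∧
        ContMDiff (𝓡 2) 𝓘(ℝ, ℝ) ∞ u ∧ ContMDiff (𝓡 2) 𝓘(ℝ, ℝ) ∞ v ∧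
        (∀ p, u p ∈ J) ∧
        (∀ p, ψ p = b + c • verticalRotation (-ζ) (catenaryMap k μ P (u p) (v p))) ∧
        (∀ p, |m p| < 1 → m p = μ (u p)) := by
  obtain ⟨a, b, hD, hpos, hm⟩ := exists_upward_cylinderData hψ hN hfin hζ hG hnc
  have hsub : k - 1 ≠ 0 := sub_ne_zero.2 hk1
  have hsm : ContDiffOn ℝ ∞
      (fun m : ℝ => 1 / (1 + m ^ 2) * ((1 + m ^ 2) / (1 - m ^ 2)) ^ ((k - 1) / 2))
      (Ioo (-1) 1) :=
    (ContDiffOn.div contDiffOn_const (by fun_prop) fun m _ => by positivity).mul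
      (contDiffOn_profile_height _)
  obtain ⟨F, G, hF, -, hFo, hGF, hGd, hGs⟩ := exists_primitive_with_inverse hsm (fun m hm => by
    have := one_sub_sq_pos hm
    positivity)
  obtain ⟨A, x₀, hA, hprof⟩ := hD.catenary_profile hk1 hpos hF
  obtain ⟨f, hcat, hmax, hfval⟩ := exists_catenary hk1 hF hFo hGF hGd hA x₀
  obtain ⟨U, μ, hμ, hUs, hμU⟩ := exists_gaussProfile k hF
  set l : M → ℝ := fun p => a p / (1 + b p) with hl
  have hlm : ∀ p, l p ∈ Ioo (-1 : ℝ) 1 := fun p => hD.slope_mem (hpos p)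
  have hκ : A * (k - 1) ≠ 0 := mul_ne_zero hA.ne' hsub
  -- This scale matches both the horizontal factor A(k-1) and the vertical factor A, and makes
  -- ck/(k-1) = A/2 positive.
  set c : ℝ := A * (k - 1) / (2 * k) with hc
  have hc1 : c * (2 * k) = A * (k - 1) := by rw [hc]; field_simp
  have hc2 : c * (2 * k / (k - 1)) = A := by rw [hc]; field_simp
  set B : E3 := verticalRotation (-ζ) !₂[-x₀, 0, 0] with hB
  have hmap : ∀ l ∈ Ioo (-1 : ℝ) 1, ∀ t : ℝ,
      B + c • verticalRotation (-ζ) (catenaryMap k μ (F ∘ μ) (U l) t) =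
      verticalRotation (-ζ) !₂[A * (k - 1) * F l - x₀, A * (k - 1) * t,
        A * ((1 + l ^ 2) / (1 - l ^ 2)) ^ ((k - 1) / 2)] := by
    intro l hl t
    rw [hB, ← verticalRotation_smul, ← verticalRotation_add]
    congr 1
    ext i
    fin_cases i
    · simp [catenaryMap, hμU l hl]
      linear_combination F l * hc1
    · simp [catenaryMap]
      linear_combination t * hc1
    · simp [catenaryMap, hμU l hl]
      linear_combination ((1 + l ^ 2) / (1 - l ^ 2)) ^ ((k - 1) / 2) * hc2
  set v : M → ℝ := fun p => -across ζ (ψ p) / (A * (k - 1)) with hv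
  have hpar : ∀ p, ψ p =
      B + c • verticalRotation (-ζ) (catenaryMap k μ (F ∘ μ) (U (l p)) (v p)) := by
    intro p
    rw [hmap _ (hlm p)]
    conv_lhs => rw [← verticalRotation_coords hζ (ψ p)]
    obtain ⟨h1, h2⟩ := hprof p
    congr 1
    ext i
    fin_cases i
    · simp [hl]
      linarith
    · simp [hv]
      field_simp
    · simp [hl, h2]
  -- The slope is a smooth function of a coordinate of ψ, which gives smoothness of U ∘ l although N
  -- is only continuous.
  have hlG : ∀ p, l p = G ((x₀ - along ζ (ψ p)) / (A * (k - 1))) := by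
    intro p
    have : (x₀ - along ζ (ψ p)) / (A * (k - 1)) = F (l p) := by
      rw [← (hprof p).1]
      field_simp
      ring
    rw [this, hGF _ (hlm p)]
  refine ⟨_, U '' Ioo (-1) 1, μ, F ∘ μ, c, B, fun p => U (l p), v, ?_, ?_, hμ, ?_, ?_, rfl,
    ?_, ?_, fun p => mem_image_of_mem _ (hlm p), hpar, ?_⟩
  · refine ⟨-ζ, _, f, by rw [norm_neg, hζ], hcat, hmax, ?_⟩
    ext q
    constructor
    · rintro ⟨_, ⟨l, hl, rfl⟩, t, rfl⟩
      rw [hmap l hl]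
      exact ⟨_, ⟨⟨l, hl, by simp⟩, by simp [hfval l hl]⟩, rfl⟩
    · rintro ⟨p, ⟨⟨l, hl, h1⟩, h2⟩, rfl⟩
      refine ⟨_, ⟨l, hl, rfl⟩, p 1 / (A * (k - 1)), ?_⟩
      rw [hmap l hl]
      congr 1
      ext i
      fin_cases i
      · simpa using h1.symm
      · simp
        field_simp
      · simp only [← h1, hfval l hl] at h2
        simpa using h2
  · rintro _ ⟨p, rfl⟩
    exact ⟨_, ⟨l p, hlm p, rfl⟩, v p, hpar p⟩
  · have : c * (k / (k - 1)) = A / 2 := by rw [hc]; field_simp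
    rw [this]
    positivity
  · simp [hB, verticalRotation]
  · intro p
    have h1 : ContMDiffAt (𝓡 2) 𝓘(ℝ, ℝ) ∞ (fun p => along ζ (ψ p)) p :=
      (along ζ).contMDiff.contMDiffAt.comp p (hψ.smooth p)
    have h2 : ContDiffAt ℝ ∞ (fun x : ℝ => U (G ((x₀ - x) / (A * (k - 1)))))
        (along ζ (ψ p)) := by
      have h3 : (x₀ - along ζ (ψ p)) / (A * (k - 1)) = F (l p) := by
        rw [← (hprof p).1]
        field_simp
        ring
      have h4 : ContDiffAt ℝ ∞ G ((x₀ - along ζ (ψ p)) / (A * (k - 1))) := by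
        rw [h3]
        exact hGs.contDiffAt (hFo.mem_nhds (mem_image_of_mem _ (hlm p)))
      have h5 : ContDiffAt ℝ ∞ U (G ((x₀ - along ζ (ψ p)) / (A * (k - 1)))) := by
        rw [← hlG]
        exact hUs.contDiffAt (isOpen_Ioo.mem_nhds (hlm p))
      have h6 : ContDiffAt ℝ ∞ (fun x : ℝ => (x₀ - x) / (A * (k - 1))) (along ζ (ψ p)) := by
        fun_prop
      exact ContDiffAt.comp (along ζ (ψ p)) h5
        (ContDiffAt.comp (f := fun x : ℝ => (x₀ - x) / (A * (k - 1))) (along ζ (ψ p)) h4 h6)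
    have h7 : (fun p => U (l p)) =
        (fun x : ℝ => U (G ((x₀ - x) / (A * (k - 1))))) ∘ fun p => along ζ (ψ p) := by
      ext p
      simp only [Function.comp_apply, hlG]
    rw [h7]
    exact h2.contMDiffAt.comp p h1
  · have h1 : ContMDiff (𝓡 2) 𝓘(ℝ, ℝ) ∞ (fun p => across ζ (ψ p)) :=
      (across ζ).contMDiff.comp hψ.smooth
    have h2 : ContDiff ℝ ∞ (fun x : ℝ => -x / (A * (k - 1))) := by fun_prop
    exact h2.contMDiff.comp h1
  · intro p hp
    simp only [hμU _ (hlm p)]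
    exact hm p hp

end SingularMinimal

end

theorem mainTheorem4
    {M : Type*} [TopologicalSpace M] [ConnectedSpace M]
    [ChartedSpace SingularMinimal.E2 M] [IsManifold (𝓡 2) ∞ M]
    (k : ℝ) (hk : k ≠ 0)
    (ψ N : M → SingularMinimal.E3)
    (hψ : SingularMinimal.IsWeightedMinimal k ψ)
    (hN : SingularMinimal.IsUnitNormal ψ N)
    (hfin : ∀ p, N p 2 ≠ -1)
    (ζ₀ : ℂ) (hζ₀ : ‖ζ₀‖ = 1) (m : M → ℝ)
    (hG : ∀ p, SingularMinimal.southStereo (N p) = ζ₀ * (m p : ℂ))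
    (hnc : ¬ ∃ c : ℂ, ∀ p, SingularMinimal.southStereo (N p) = c) :
    (k = 1 →
      ∃ (S : Set SingularMinimal.E3) (b : SingularMinimal.E3) (u v : M → ℝ),
        SingularMinimal.IsGrimReaperCylinder S ∧
        Set.range ψ ⊆ S ∧
        S = {q | ∃ s t : ℝ, q = b + SingularMinimal.verticalRotation (-ζ₀)
              (SingularMinimal.grimReaperMap s t)} ∧
        ContMDiff (𝓡 2) 𝓘(ℝ, ℝ) ∞ u ∧ ContMDiff (𝓡 2) 𝓘(ℝ, ℝ) ∞ v ∧
        (∀ p, ψ p = b + SingularMinimal.verticalRotation (-ζ₀)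
              (SingularMinimal.grimReaperMap (u p) (v p))) ∧
        (∀ p, |m p| < 1 → m p = Real.tanh (u p))) ∧
    (k ≠ 1 →
      ∃ (S : Set SingularMinimal.E3) (J : Set ℝ) (μ P : ℝ → ℝ) (c : ℝ)
        (b : SingularMinimal.E3) (u v : M → ℝ),
        SingularMinimal.IsCatenaryCylinder (2 / (k - 1)) S ∧
        Set.range ψ ⊆ S ∧
        SingularMinimal.IsGaussProfile k J μ P ∧
        0 < c * (k / (k - 1)) ∧ b 2 = 0 ∧
        S = {q | ∃ s ∈ J, ∃ t : ℝ, q = b + c • SingularMinimal.verticalRotation (-ζ₀)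
              (SingularMinimal.catenaryMap k μ P s t)} ∧
        ContMDiff (𝓡 2) 𝓘(ℝ, ℝ) ∞ u ∧ ContMDiff (𝓡 2) 𝓘(ℝ, ℝ) ∞ v ∧
        (∀ p, u p ∈ J) ∧
        (∀ p, ψ p = b + c • SingularMinimal.verticalRotation (-ζ₀)
              (SingularMinimal.catenaryMap k μ P (u p) (v p))) ∧
        (∀ p, |m p| < 1 → m p = μ (u p))) := by
  refine ⟨?_, fun hk1 => ?_⟩
  · rintro rfl
    exact SingularMinimal.range_subset_grimReaperCylinder hψ hN hfin hζ₀ hG hnc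
  · exact SingularMinimal.range_subset_catenaryCylinder hk hk1 hψ hN hfin hζ₀ hG hnc
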